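/- All $C^*$-algebras are finite-dimensional over $\mathbb C$ and unital. A \emph{generalized coinvolutive $C^*$-bialgebra} $(M,\Delta,S)$ is a $C^*$-algebra $M$ with an injective coassociative (not necessarily unital) $*$-homomorphism $\Delta:M\to M\otimes M$ and a unital linear $*$-anti-automorphism $S$ of $M$ with $S^2=\mathrm{id}$ and $(S\otimes S)\Delta=\varsigma\Delta S$, where $\varsigma$ is the flip. Homomorphisms are the unital $*$-homomorphisms that commute with $\Delta$ and $S$. Put $e=\Delta(1)$, $\varepsilon_t=\mu(\mathrm{id}\otimes S)\Delta$ and $\varepsilon_s=\mu(S\otimes\mathrm{id})\Delta$, where $\mu$ is the multiplication of $M$. $(M,\Delta,S,\phi)$ is a \emph{generalized Kac algebra}, and $\phi$ is a \emph{Haar trace}, if $\phi$ is a faithful (positive) trace on $M$ with $\phi\circ S=\phi$ and $(\mathrm{id}\otimes\phi)[(1\otimes y)\Delta(x)]=S[(\mathrm{id}\otimes\phi)(\Delta(y)(1\otimes x))]$ for all $x,y\in M$. A functional $\phi$ is \emph{normalized} if $(\mathrm{id}\otimes\phi)(e)=1$. $(M,\Delta,S,\varepsilon)$ is a \emph{weak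 Kac algebra} if $\varepsilon:M\to\mathbb C$ is linear, $(\varepsilon\otimes\mathrm{id})\Delta=(\mathrm{id}\otimes\varepsilon)\Delta=\mathrm{id}$, and for all $x,y\in M$: $\varepsilon(S(x))=\varepsilon(x)$, $\varepsilon(x^*)=\overline{\varepsilon(x)}$, $(\varepsilon\otimes\varepsilon)((x\otimes1)e(1\otimes y))=\varepsilon(xy)$ and $(\varepsilon_s\otimes\mathrm{id})\Delta(x)=(1\otimes x)e$. The dual algebra $\hat M$ is the dual space of $M$ with the product $\alpha\beta=(\alpha\otimes\beta)\Delta$. If $\phi$ is a Haar trace, $y\in M$ is identified with the functional $x\mapsto\phi(yx)$ in $\hat M$. \textbf{Theorem.} (1) Let $(M,\Delta,S,\phi)$ be a generalized Kac algebra. Then $\hat M$ has a unit; it corresponds to a unique $\hat 1\in M$, and with $\varepsilon(x)=\phi(\hat 1x)$ the quadruple $(M,\Delta,S,\varepsilon)$ is a weak Kac algebra. There is a unique normalized Haar trace $\psi$ for $(M,\Delta,S)$. There is likewise a unique normalized faithful trace $\psi$ with $\psi\circ S=\psi$ and $(\mathrm{id}\otimes\psi)\Delta=(\varepsilon_t\otimes\psi)\Delta$.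 (2) Conversely, let $(M,\Delta,S,\varepsilon)$ be a weak Kac algebra. Then $\varepsilon$ is the unit of $\hat M$, there is a faithful trace $\phi$ with $\phi\circ S=\phi$ and $(\mathrm{id}\otimes\phi)\Delta=(\varepsilon_t\otimes\phi)\Delta$, and for every such $\phi$ the quadruple $(M,\Delta,S,\phi)$ is a generalized Kac algebra. (3) Let a homomorphism of generalized Kac algebras be a homomorphism $\pi$ of generalized coinvolutive $C^*$-bialgebras with $\psi_2\circ\pi=\psi_1$ for the normalized Haar traces $\psi_1,\psi_2$, and let a homomorphism of weak Kac algebras be one with $\varepsilon_2\circ\pi=\varepsilon_1$. Then $(M,\Delta,S,\phi)\mapsto(M,\Delta,S,\varepsilon)$, with $\varepsilon$ as in (1), and $\pi\mapsto\pi$ define an equivalence from the category of generalized Kac algebras to the category of weak Kac algebras and their injective homomorphisms. If instead the homomorphisms of generalized Kac algebras are the homomorphisms of generalized coinvolutive $C^*$-bialgebras whose transpose $\hat M_2\to\hat M_1$ preserves the unit, the same assignments define an equivalence onto the category of weak Kac algebras and all their homomorphisms. -/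

import Mathlib

open scoped TensorProduct ComplexOrder
open CategoryTheory

universe u

/-- A generalized coinvolutive `C^*`-bialgebra: a finite-dimensional `C^*`-algebra `M` with an
injective, coassociative, not necessarily unital `*`-homomorphism `Δ : M → M ⊗ M` (the coproduct)
and an involutive unital `*`-anti-automorphism `S` with `(S ⊗ S) ∘ Δ = flip ∘ Δ ∘ S`. -/
structure CoinvBialg : Type (u + 1) where
  carrier : Type u
  [cstar : CStarAlgebra carrier]
  [finDim : FiniteDimensional ℂ carrier]
  Δ : carrier →⋆ₙₐ[ℂ] carrier ⊗[ℂ] carrier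
  S : carrier →ₗ[ℂ] carrier
  Δ_injective : Function.Injective Δ
  coassoc : ∀ x, TensorProduct.assoc ℂ carrier carrier carrier
      ((Δ : carrier →ₗ[ℂ] carrier ⊗[ℂ] carrier).rTensor carrier (Δ x)) =
    (Δ : carrier →ₗ[ℂ] carrier ⊗[ℂ] carrier).lTensor carrier (Δ x)
  S_one : S 1 = 1
  S_mul : ∀ x y, S (x * y) = S y * S x
  S_star : ∀ x, S (star x) = star (S x)
  S_S : ∀ x, S (S x) = x
  S_Δ : ∀ x, TensorProduct.map S S (Δ x) = TensorProduct.comm ℂ carrier carrier (Δ (S x))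

namespace CoinvBialg

instance : CoeSort CoinvBialg.{u} (Type u) := ⟨carrier⟩

attribute [instance] cstar finDim

/-- A homomorphism of generalized coinvolutive `C^*`-bialgebras: a unital `*`-homomorphism that
intertwines the coproducts and the co-involutions. -/
@[ext]
structure Hom (B C : CoinvBialg.{u}) where
  toFun : B →⋆ₐ[ℂ] C
  map_Δ : ∀ x, C.Δ (toFun x) =
    TensorProduct.map (toFun : B →ₗ[ℂ] C) (toFun : B →ₗ[ℂ] C) (B.Δ x)
  map_S : ∀ x, C.S (toFun x) = toFun (B.S x)

/-- The linear map underlying a homomorphism. -/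
noncomputable def Hom.lin {B C : CoinvBialg.{u}} (f : B.Hom C) : B →ₗ[ℂ] C := (f.toFun : B →ₗ[ℂ] C)

instance category : Category CoinvBialg.{u} where
  Hom B C := B.Hom C
  id B :=
    { toFun := StarAlgHom.id ℂ B
      map_Δ := fun x => by
        have h : ((StarAlgHom.id ℂ B : B →⋆ₐ[ℂ] B) : B →ₗ[ℂ] B) = LinearMap.id := rfl
        rw [h, TensorProduct.map_id]; rfl
      map_S := fun _ => rfl }
  comp {B C D} f g :=
    { toFun := g.toFun.comp f.toFun
      map_Δ := fun x => by
        have h : ((g.toFun.comp f.toFun : B →⋆ₐ[ℂ] D) : B →ₗ[ℂ] D) =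
          (g.toFun : C →ₗ[ℂ] D) ∘ₗ (f.toFun : B →ₗ[ℂ] C) := rfl
        rw [h, TensorProduct.map_comp, LinearMap.comp_apply, ← f.map_Δ, ← g.map_Δ]; rfl
      map_S := fun x => by
        simp only [StarAlgHom.comp_apply, g.map_S, f.map_S] }

theorem lin_id (B : CoinvBialg.{u}) : Hom.lin (𝟙 B) = LinearMap.id := rfl

theorem lin_comp {B C D : CoinvBialg.{u}} (f : B ⟶ C) (g : C ⟶ D) :
    Hom.lin (f ≫ g) = Hom.lin g ∘ₗ Hom.lin f := rfl

section Notions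

variable (B : CoinvBialg.{u})

/-- `(α ⊗ id) : M ⊗ M → M`. -/
noncomputable def sliceLeft (α : B →ₗ[ℂ] ℂ) : B ⊗[ℂ] B →ₗ[ℂ] B :=
  (TensorProduct.lid ℂ B).toLinearMap ∘ₗ α.rTensor B

/-- `(id ⊗ α) : M ⊗ M → M`. -/
noncomputable def sliceRight (α : B →ₗ[ℂ] ℂ) : B ⊗[ℂ] B →ₗ[ℂ] B :=
  (TensorProduct.rid ℂ B).toLinearMap ∘ₗ α.lTensor B

/-- `(α ⊗ β) : M ⊗ M → ℂ`. -/
noncomputable def tensorFunctional (α β : B →ₗ[ℂ] ℂ) : B ⊗[ℂ] B →ₗ[ℂ] ℂ :=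
  LinearMap.mul' ℂ ℂ ∘ₗ TensorProduct.map α β

/-- The coproduct as a linear map. -/
noncomputable def ΔLin : B →ₗ[ℂ] B ⊗[ℂ] B := (B.Δ : B →ₗ[ℂ] B ⊗[ℂ] B)

/-- `e = Δ(1)`. -/
noncomputable def e : B ⊗[ℂ] B := B.Δ 1

/-- The target counital map `ε_t = μ (id ⊗ S) Δ`. -/
noncomputable def targetMap : B →ₗ[ℂ] B :=
  LinearMap.mul' ℂ B ∘ₗ B.S.lTensor B ∘ₗ B.ΔLin

/-- The source counital map `ε_s = μ (S ⊗ id) Δ`. -/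
noncomputable def sourceMap : B →ₗ[ℂ] B :=
  LinearMap.mul' ℂ B ∘ₗ B.S.rTensor B ∘ₗ B.ΔLin

/-- The product of the dual space of `M`, the transpose of the coproduct. -/
noncomputable def dualMul (α β : B →ₗ[ℂ] ℂ) : B →ₗ[ℂ] ℂ := B.tensorFunctional α β ∘ₗ B.ΔLin

/-- `υ` is a (two-sided) unit of the dual algebra. -/
def IsDualUnit (υ : B →ₗ[ℂ] ℂ) : Prop :=
  ∀ α : B →ₗ[ℂ] ℂ, B.dualMul υ α = α ∧ B.dualMul α υ = α

/-- The functional `x ↦ φ(y x)`. -/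
noncomputable def densityFunctional (φ : B →ₗ[ℂ] ℂ) (y : B) : B →ₗ[ℂ] ℂ :=
  φ ∘ₗ LinearMap.mulLeft ℂ y

/-- A faithful (positive) trace on the algebra `M`. -/
structure IsFaithfulTrace (φ : B →ₗ[ℂ] ℂ) : Prop where
  trace : ∀ x y, φ (x * y) = φ (y * x)
  pos : ∀ x, x ≠ 0 → 0 < φ (star x * x)

/-- `φ` is a Haar trace in the sense of generalized Kac algebras, that is, `(M, Δ, S, φ)` is a
generalized Kac algebra: `φ` is a faithful trace, `φ ∘ S = φ`, and
`(id ⊗ φ)[(1 ⊗ y) Δ(x)] = S[(id ⊗ φ)(Δ(y) (1 ⊗ x))]`. -/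
structure IsHaarTrace (φ : B →ₗ[ℂ] ℂ) : Prop extends B.IsFaithfulTrace φ where
  comp_S : ∀ x, φ (B.S x) = φ x
  invariant : ∀ x y, B.sliceRight φ (((1 : B) ⊗ₜ[ℂ] y) * B.Δ x) =
    B.S (B.sliceRight φ (B.Δ y * ((1 : B) ⊗ₜ[ℂ] x)))

/-- `φ` is a Haar trace in the sense of counital bialgebras: a faithful trace with `φ ∘ S = φ`
and `(id ⊗ φ) Δ = (ε_t ⊗ φ) Δ`. -/
structure IsCounitalHaarTrace (φ : B →ₗ[ℂ] ℂ) : Prop extends B.IsFaithfulTrace φ where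
  comp_S : ∀ x, φ (B.S x) = φ x
  invariant : ∀ x, B.sliceRight φ (B.Δ x) =
    B.sliceRight φ (B.targetMap.rTensor B (B.Δ x))

/-- `φ` is normalized: `(id ⊗ φ)(e) = 1`. -/
def IsNormalized (φ : B →ₗ[ℂ] ℂ) : Prop := B.sliceRight φ B.e = 1

/-- `(M, Δ, S, ε)` is a weak Kac algebra. -/
structure IsWeakKac (ε : B →ₗ[ℂ] ℂ) : Prop where
  counit_left : ∀ x, B.sliceLeft ε (B.Δ x) = x
  counit_right : ∀ x, B.sliceRight ε (B.Δ x) = x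
  counit_S : ∀ x, ε (B.S x) = ε x
  counit_star : ∀ x, ε (star x) = star (ε x)
  counit_mul : ∀ x y, B.tensorFunctional ε ε
    ((x ⊗ₜ[ℂ] (1 : B)) * B.e * ((1 : B) ⊗ₜ[ℂ] y)) = ε (x * y)
  source : ∀ x, B.sourceMap.rTensor B (B.Δ x) = ((1 : B) ⊗ₜ[ℂ] x) * B.e

end Notions

/-- The homomorphisms along which normalized Haar traces pull back to normalized Haar traces. As
normalized Haar traces exist and are unique on generalized Kac algebras, between those this says
`ψ₂ ∘ π = ψ₁` for the normalized Haar traces `ψ₁`, `ψ₂`. -/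
def preservesHaar : MorphismProperty CoinvBialg.{u} := fun B C (π : B.Hom C) =>
  ∀ ψ : C →ₗ[ℂ] ℂ, C.IsHaarTrace ψ → C.IsNormalized ψ →
    B.IsHaarTrace (ψ ∘ₗ π.lin) ∧ B.IsNormalized (ψ ∘ₗ π.lin)

instance : preservesHaar.{u}.IsMultiplicative where
  id_mem B := fun ψ h h' => by
    rw [lin_id, LinearMap.comp_id]
    exact ⟨h, h'⟩
  comp_mem f g hf hg := fun ψ h h' => by
    rw [lin_comp, ← LinearMap.comp_assoc]
    exact hf _ (hg ψ h h').1 (hg ψ h h').2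

/-- The homomorphisms whose transpose maps the unit of the dual algebra to the unit of the dual
algebra. -/
def preservesDualUnit : MorphismProperty CoinvBialg.{u} := fun B C (π : B.Hom C) =>
  ∀ υ : C →ₗ[ℂ] ℂ, C.IsDualUnit υ → B.IsDualUnit (υ ∘ₗ π.lin)

instance : preservesDualUnit.{u}.IsMultiplicative where
  id_mem B := fun υ h => by
    rw [lin_id, LinearMap.comp_id]
    exact h
  comp_mem f g hf hg := fun υ h => by
    rw [lin_comp, ← LinearMap.comp_assoc]
    exact hf _ (hg υ h)

end CoinvBialg

/-- A generalized Kac algebra `(M, Δ, S, φ)`. -/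
structure GenKacAlg : Type (u + 1) where
  bialg : CoinvBialg.{u}
  φ : bialg →ₗ[ℂ] ℂ
  isHaarTrace : bialg.IsHaarTrace φ

/-- The category of generalized Kac algebras; its morphisms are the homomorphisms of generalized
coinvolutive `C^*`-bialgebras that preserve the normalized Haar traces. -/
abbrev GenKacCat : Type (u + 1) :=
  InducedWideCategory CoinvBialg.{u} GenKacAlg.bialg.{u} CoinvBialg.preservesHaar.{u}

/-- Generalized Kac algebras with the homomorphisms of generalized coinvolutive
`C^*`-bialgebras that preserve the units of the dual algebras. -/
abbrev GenKacCounitCat : Type (u + 1) :=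
  InducedWideCategory CoinvBialg.{u} GenKacAlg.bialg.{u} CoinvBialg.preservesDualUnit.{u}

/-- A weak Kac algebra `(M, Δ, S, ε)`. -/
structure WeakKacAlg : Type (u + 1) where
  bialg : CoinvBialg.{u}
  ε : bialg →ₗ[ℂ] ℂ
  isWeakKac : bialg.IsWeakKac ε

namespace WeakKacAlg

/-- A homomorphism of weak Kac algebras: a homomorphism of the underlying bialgebras with
`ε₂ ∘ π = ε₁`. -/
@[ext]
structure Hom (X Y : WeakKacAlg.{u}) where
  hom : X.bialg ⟶ Y.bialg
  map_ε : Y.ε ∘ₗ CoinvBialg.Hom.lin hom = X.ε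

instance category : Category WeakKacAlg.{u} where
  Hom X Y := X.Hom Y
  id X := ⟨𝟙 X.bialg, rfl⟩
  comp f g := ⟨f.hom ≫ g.hom, by
    rw [← f.map_ε, ← g.map_ε]; rfl⟩

/-- The functor that forgets the counit. -/
def forgetCounit : WeakKacAlg.{u} ⥤ CoinvBialg.{u} where
  obj X := X.bialg
  map f := f.hom

/-- The injective homomorphisms of weak Kac algebras. -/
def injective : MorphismProperty WeakKacAlg.{u} := fun X Y (f : X.Hom Y) =>
  Function.Injective (CoinvBialg.Hom.lin f.hom)

instance : injective.{u}.IsMultiplicative where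
  id_mem _ := fun _ _ h => h
  comp_mem _ _ hf hg := fun _ _ h => hf (hg h)

end WeakKacAlg

/-- The category of weak Kac algebras and their injective homomorphisms. -/
abbrev WeakKacInjCat : Type (u + 1) := WideSubcategory WeakKacAlg.injective.{u}

/-! The bridge between the two notions is the identity `(ε_s ⊗ id) Δ(x) = (1 ⊗ x) e`. By
coassociativity its left side is `(S(x₁) ⊗ 1) Δ(x₂)`, and slicing with `φ(y ·)` derives it from Haar
invariance (`IsHaarTrace.sourceCompatible`). Once it holds, the two forms of invariance agree
(`SourceCompatible.isCounitalHaarTrace_iff`).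

From a Haar trace to a counit: the operators `L_α = (α ⊗ id) Δ` depend injectively on `α`, satisfy
`L_β L_α = L_{αβ}`, and are closed under adjoints for `⟪x, y⟫ = φ(x^* y)`. Hence the form `Tr(L_α
L_u)` is nondegenerate, and the `u` representing `α ↦ Tr L_α` is a unit of the dual
(`IsHaarTrace.exists_isDualUnit`). Invariance, applied to the density of the counit, gives the
remaining axioms (`IsHaarTrace.isWeakKac`). The element `n = (id ⊗ φ)(e)` is central and invertible,
and `φ(n⁻¹ ·)` is the normalized Haar trace; two normalized Haar traces absorb each other in the
dual product, so they coincide.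

From a counit to a Haar trace: the trace of the regular representation, symmetrized under `S`, is
faithful by spectral theory and invariant by a cyclicity argument (`trace_eq_trace_comp_leftOp`).

For the categories, faithfulness of `ψ₂ ∘ π` forces `π` to be injective, and along an injective `π`
every invariance identity can be tested in the target. The counit is the unit of the dual, so the
bialgebra determines it, and both functors are fully faithful and surjective on objects. -/

namespace CoinvBialg

variable (B : CoinvBialg.{u})

/-! ### Calculus of slice maps on the tensor square -/

section Slices

@[simp]
theorem sliceLeft_tmul (α : B →ₗ[ℂ] ℂ) (a b : B) : B.sliceLeft α (a ⊗ₜ b) = α a • b := by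
  simp [sliceLeft]

@[simp]
theorem sliceRight_tmul (α : B →ₗ[ℂ] ℂ) (a b : B) : B.sliceRight α (a ⊗ₜ b) = α b • a := by
  simp [sliceRight]

@[simp]
theorem tensorFunctional_tmul (α β : B →ₗ[ℂ] ℂ) (a b : B) :
    B.tensorFunctional α β (a ⊗ₜ b) = α a * β b := by
  simp [tensorFunctional]

theorem tensorFunctional_eq_left (α β : B →ₗ[ℂ] ℂ) (t : B ⊗[ℂ] B) :
    B.tensorFunctional α β t = α (B.sliceRight β t) := by
  induction t with
  | zero => simp
  | tmul a b => simp [mul_comm]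
  | add s t hs ht => simp [hs, ht]

theorem tensorFunctional_eq_right (α β : B →ₗ[ℂ] ℂ) (t : B ⊗[ℂ] B) :
    B.tensorFunctional α β t = β (B.sliceLeft α t) := by
  induction t with
  | zero => simp
  | tmul a b => simp
  | add s t hs ht => simp [hs, ht]

theorem tensorFunctional_comm (α β : B →ₗ[ℂ] ℂ) (t : B ⊗[ℂ] B) :
    B.tensorFunctional α β (TensorProduct.comm ℂ B B t) = B.tensorFunctional β α t := by
  induction t with
  | zero => simp
  | tmul a b => simp [mul_comm]
  | add s t hs ht => simp [hs, ht]

theorem tensorFunctional_comp (f g : B →ₗ[ℂ] B) (α β : B →ₗ[ℂ] ℂ) (t : B ⊗[ℂ] B) :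
    B.tensorFunctional (α ∘ₗ f) (β ∘ₗ g) t =
      B.tensorFunctional α β (TensorProduct.map f g t) := by
  induction t with
  | zero => simp
  | tmul a b => simp
  | add s t hs ht => simp [hs, ht]

@[simp]
theorem dualMul_apply (α β : B →ₗ[ℂ] ℂ) (x : B) :
    B.dualMul α β x = B.tensorFunctional α β (B.Δ x) := rfl

@[simp]
theorem densityFunctional_apply (φ : B →ₗ[ℂ] ℂ) (x y : B) :
    B.densityFunctional φ y x = φ (y * x) := rfl

theorem eq_of_forall_functional {x y : B} (h : ∀ α : B →ₗ[ℂ] ℂ, α x = α y) : x = y :=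
  Module.forall_dual_apply_eq_zero_iff ℂ (x - y) |>.1 (fun α => by simp [h α]) |> sub_eq_zero.1

theorem eq_of_forall_sliceRight {s t : B ⊗[ℂ] B}
    (h : ∀ α : B →ₗ[ℂ] ℂ, B.sliceRight α s = B.sliceRight α t) : s = t := by
  let b := Module.finBasis ℂ B
  have key : ∀ t : B ⊗[ℂ] B, t = ∑ i, B.sliceRight (b.coord i) t ⊗ₜ[ℂ] b i := by
    intro t
    induction t with
    | zero => simp
    | tmul x y =>
      simp only [sliceRight_tmul, Module.Basis.coord_apply, TensorProduct.smul_tmul]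
      rw [← TensorProduct.tmul_sum, b.sum_repr]
    | add s t hs ht =>
      simp only [map_add, TensorProduct.add_tmul, Finset.sum_add_distrib]
      rw [← hs, ← ht]
  rw [key s, key t]
  simp only [h]

theorem sliceRight_one_tmul_mul (φ : B →ₗ[ℂ] ℂ) (y : B) (t : B ⊗[ℂ] B) :
    B.sliceRight φ (((1 : B) ⊗ₜ y) * t) = B.sliceRight (B.densityFunctional φ y) t := by
  induction t with
  | zero => simp
  | tmul a b => simp
  | add s t hs ht => simp [mul_add, hs, ht]

theorem sliceRight_tmul_one_mul (φ : B →ₗ[ℂ] ℂ) (y : B) (t : B ⊗[ℂ] B) :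
    B.sliceRight φ ((y ⊗ₜ (1 : B)) * t) = y * B.sliceRight φ t := by
  induction t with
  | zero => simp
  | tmul a b => simp
  | add s t hs ht => simp [mul_add, hs, ht]

theorem sliceRight_mul_tmul_one (φ : B →ₗ[ℂ] ℂ) (y : B) (t : B ⊗[ℂ] B) :
    B.sliceRight φ (t * (y ⊗ₜ (1 : B))) = B.sliceRight φ t * y := by
  induction t with
  | zero => simp
  | tmul a b => simp
  | add s t hs ht => simp [add_mul, hs, ht]

theorem sliceLeft_one_tmul_mul (φ : B →ₗ[ℂ] ℂ) (y : B) (t : B ⊗[ℂ] B) :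
    B.sliceLeft φ (((1 : B) ⊗ₜ y) * t) = y * B.sliceLeft φ t := by
  induction t with
  | zero => simp
  | tmul a b => simp
  | add s t hs ht => simp [mul_add, hs, ht]

theorem sliceLeft_mul_one_tmul (φ : B →ₗ[ℂ] ℂ) (y : B) (t : B ⊗[ℂ] B) :
    B.sliceLeft φ (t * ((1 : B) ⊗ₜ y)) = B.sliceLeft φ t * y := by
  induction t with
  | zero => simp
  | tmul a b => simp
  | add s t hs ht => simp [add_mul, hs, ht]

theorem sliceRight_rTensor (α : B →ₗ[ℂ] ℂ) (f : B →ₗ[ℂ] B) (t : B ⊗[ℂ] B) :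
    B.sliceRight α (f.rTensor B t) = f (B.sliceRight α t) := by
  induction t with
  | zero => simp
  | tmul a b => simp
  | add s t hs ht => simp [hs, ht]

theorem sliceLeft_rTensor (α : B →ₗ[ℂ] ℂ) (f : B →ₗ[ℂ] B) (t : B ⊗[ℂ] B) :
    B.sliceLeft α (f.rTensor B t) = B.sliceLeft (α ∘ₗ f) t := by
  induction t with
  | zero => simp
  | tmul a b => simp
  | add s t hs ht => simp [hs, ht]

theorem sliceRight_lTensor (α : B →ₗ[ℂ] ℂ) (f : B →ₗ[ℂ] B) (t : B ⊗[ℂ] B) :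
    B.sliceRight α (f.lTensor B t) = B.sliceRight (α ∘ₗ f) t := by
  induction t with
  | zero => simp
  | tmul a b => simp
  | add s t hs ht => simp [hs, ht]

theorem sliceLeft_comm (α : B →ₗ[ℂ] ℂ) (t : B ⊗[ℂ] B) :
    B.sliceLeft α (TensorProduct.comm ℂ B B t) = B.sliceRight α t := by
  induction t with
  | zero => simp
  | tmul a b => simp
  | add s t hs ht => simp [hs, ht]

end Slices

/-! ### The coinvolution, and coassociativity in sliced form -/

section Coinvolution

theorem star_e : star B.e = B.e := by
  simp [e, ← map_star]

theorem e_mul_Δ (x : B) : B.e * B.Δ x = B.Δ x := by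
  simp [e, ← map_mul]

theorem Δ_mul_e (x : B) : B.Δ x * B.e = B.Δ x := by
  simp [e, ← map_mul]

theorem map_S_mul (s t : B ⊗[ℂ] B) : TensorProduct.map B.S B.S (s * t) =
    TensorProduct.map B.S B.S t * TensorProduct.map B.S B.S s := by
  induction s with
  | zero => simp
  | add s s' hs hs' => simp [add_mul, mul_add, hs, hs']
  | tmul a b =>
    induction t with
    | zero => simp
    | add s s' hs hs' => simp [add_mul, mul_add, hs, hs']
    | tmul c d => simp [B.S_mul]

theorem comm_mul (s t : B ⊗[ℂ] B) : TensorProduct.comm ℂ B B (s * t) =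
    TensorProduct.comm ℂ B B s * TensorProduct.comm ℂ B B t :=
  map_mul (Algebra.TensorProduct.comm ℂ B B) s t

theorem comm_comm (t : B ⊗[ℂ] B) :
    TensorProduct.comm ℂ B B (TensorProduct.comm ℂ B B t) = t :=
  (TensorProduct.comm ℂ B B).symm_apply_apply t

theorem map_S_map_S (t : B ⊗[ℂ] B) :
    TensorProduct.map B.S B.S (TensorProduct.map B.S B.S t) = t := by
  induction t with
  | zero => simp
  | tmul a b => simp [B.S_S]
  | add s t hs ht => simp [hs, ht]

theorem Δ_S (x : B) :
    B.Δ (B.S x) = TensorProduct.comm ℂ B B (TensorProduct.map B.S B.S (B.Δ x)) := by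
  rw [B.S_Δ, comm_comm]

theorem comm_e : TensorProduct.comm ℂ B B B.e = TensorProduct.map B.S B.S B.e := by
  rw [e, B.S_Δ, B.S_one]

theorem sliceRight_comm_map_S (α : B →ₗ[ℂ] ℂ) (t : B ⊗[ℂ] B) :
    B.sliceRight α (TensorProduct.comm ℂ B B (TensorProduct.map B.S B.S t)) =
      B.S (B.sliceLeft (α ∘ₗ B.S) t) := by
  induction t with
  | zero => simp
  | tmul a b => simp
  | add s t hs ht => simp [hs, ht]

/-- The linear map `a ⊗ b ↦ (S(a) ⊗ 1) Δ(b)`. -/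
noncomputable def antipodeMulΔ : B ⊗[ℂ] B →ₗ[ℂ] B ⊗[ℂ] B :=
  LinearMap.mul' ℂ (B ⊗[ℂ] B) ∘ₗ
    TensorProduct.map ((TensorProduct.mk ℂ B B).flip 1 ∘ₗ B.S) B.ΔLin

@[simp]
theorem antipodeMulΔ_tmul (a b : B) :
    B.antipodeMulΔ (a ⊗ₜ b) = (B.S a ⊗ₜ (1 : B)) * B.Δ b := rfl

theorem sourceMap_rTensor_Δ (x : B) :
    B.sourceMap.rTensor B (B.Δ x) = B.antipodeMulΔ (B.Δ x) := by
  -- Both sides are `S(x₁) x₂ ⊗ x₃`: `H` contracts the first two legs of the iterated coproduct,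
  -- bracketed in the two ways.
  let H : (B ⊗[ℂ] B) ⊗[ℂ] B →ₗ[ℂ] B ⊗[ℂ] B :=
    (LinearMap.mul' ℂ B ∘ₗ B.S.rTensor B).rTensor B
  have h₁ : ∀ t : B ⊗[ℂ] B, B.sourceMap.rTensor B t =
      H ((B.Δ : B →ₗ[ℂ] B ⊗[ℂ] B).rTensor B t) := by
    intro t
    induction t with
    | zero => simp
    | tmul a b => simp [H, sourceMap, ΔLin]
    | add s t hs ht => simp [hs, ht]
  have h₂ : ∀ (a : B) (t : B ⊗[ℂ] B),
      (B.S a ⊗ₜ (1 : B)) * t = H ((TensorProduct.assoc ℂ B B B).symm (a ⊗ₜ t)) := by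
    intro a t
    induction t with
    | zero => simp
    | tmul c d => simp [H]
    | add s t hs ht => simp [mul_add, TensorProduct.tmul_add, hs, ht]
  have h₃ : ∀ t : B ⊗[ℂ] B, B.antipodeMulΔ t = H ((TensorProduct.assoc ℂ B B B).symm
      ((B.Δ : B →ₗ[ℂ] B ⊗[ℂ] B).lTensor B t)) := by
    intro t
    induction t with
    | zero => simp
    | tmul a b => simp [h₂]
    | add s t hs ht => simp [hs, ht]
  rw [h₁, h₃, ← B.coassoc, LinearEquiv.symm_apply_apply]

theorem Δ_sliceRight_Δ (α : B →ₗ[ℂ] ℂ) (x : B) :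
    B.Δ (B.sliceRight α (B.Δ x)) =
      (B.sliceRight α ∘ₗ B.ΔLin).lTensor B (B.Δ x) := by
  let H : B ⊗[ℂ] (B ⊗[ℂ] B) →ₗ[ℂ] B ⊗[ℂ] B := (B.sliceRight α).lTensor B
  have h₂ : ∀ (t : B ⊗[ℂ] B) (a : B),
      α a • t = H (TensorProduct.assoc ℂ B B B (t ⊗ₜ a)) := by
    intro t a
    induction t with
    | zero => simp
    | tmul c d => simp [H]
    | add s t hs ht => simp [TensorProduct.add_tmul, hs, ht]
  have h₁ : ∀ t : B ⊗[ℂ] B, B.Δ (B.sliceRight α t) =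
      H (TensorProduct.assoc ℂ B B B ((B.Δ : B →ₗ[ℂ] B ⊗[ℂ] B).rTensor B t)) := by
    intro t
    induction t with
    | zero => simp
    | tmul a b => simp [← h₂, map_smul]
    | add s t hs ht => simp [hs, ht]
  have h₃ : ∀ t : B ⊗[ℂ] B, (B.sliceRight α ∘ₗ B.ΔLin).lTensor B t =
      H ((B.Δ : B →ₗ[ℂ] B ⊗[ℂ] B).lTensor B t) := by
    intro t
    induction t with
    | zero => simp
    | tmul a b => simp [H, ΔLin]
    | add s t hs ht => simp [hs, ht]
  rw [h₁, h₃, B.coassoc]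

theorem dualMul_assoc (α β γ : B →ₗ[ℂ] ℂ) :
    B.dualMul (B.dualMul α β) γ = B.dualMul α (B.dualMul β γ) := by
  ext x
  have h := congrArg (B.tensorFunctional α β) (B.Δ_sliceRight_Δ γ x)
  rw [tensorFunctional_eq_left, tensorFunctional_eq_left B α β (LinearMap.lTensor _ _ _),
    sliceRight_lTensor, ← tensorFunctional_eq_left] at h
  have hβ : β ∘ₗ B.sliceRight γ ∘ₗ B.ΔLin = B.dualMul β γ := by
    ext y
    simp [ΔLin, tensorFunctional_eq_left]
  rw [dualMul_apply, dualMul_apply, tensorFunctional_eq_left, dualMul_apply, h, hβ,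
    tensorFunctional_eq_left]

theorem dualMul_comp_S (α β : B →ₗ[ℂ] ℂ) :
    B.dualMul (α ∘ₗ B.S) (β ∘ₗ B.S) = B.dualMul β α ∘ₗ B.S := by
  ext x
  simp only [dualMul_apply, tensorFunctional_comp, LinearMap.comp_apply, B.S_Δ,
    tensorFunctional_comm]

end Coinvolution

end CoinvBialg

namespace CoinvBialg

variable {B : CoinvBialg.{u}}

/-! ### Counital maps and the four mirror images of the source identity -/

section SourceAxiom

theorem S_targetMap (x : B) : B.S (B.targetMap x) = B.sourceMap (B.S x) := by
  have key : ∀ t : B ⊗[ℂ] B, B.S (LinearMap.mul' ℂ B (B.S.lTensor B t)) =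
      LinearMap.mul' ℂ B (B.S.rTensor B
        (TensorProduct.comm ℂ B B (TensorProduct.map B.S B.S t))) := by
    intro t
    induction t with
    | zero => simp
    | tmul a b => simp [B.S_mul]
    | add s t hs ht => simp only [map_add, hs, ht]
  have h := key (B.Δ x)
  rw [← Δ_S] at h
  exact h

theorem star_sourceMap_star (x : B) :
    star (B.sourceMap (star x)) = B.S (B.targetMap x) := by
  have key : ∀ t : B ⊗[ℂ] B, star (LinearMap.mul' ℂ B (B.S.rTensor B (star t))) =
      B.S (LinearMap.mul' ℂ B (B.S.lTensor B t)) := by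
    intro t
    induction t with
    | zero => simp
    | tmul a b => simp [B.S_mul, B.S_star, B.S_S]
    | add s t hs ht => simp only [map_add, star_add, hs, ht]
  have h := key (B.Δ x)
  rw [← map_star B.Δ] at h
  exact h

theorem star_targetMap_star (x : B) :
    star (B.targetMap (star x)) = B.S (B.sourceMap x) := by
  have h := B.star_sourceMap_star (star x)
  rw [star_star] at h
  have h' := congrArg (fun z => star (B.S z)) h
  simp only [B.S_S] at h'
  rw [← h', B.S_star, star_star]

/-- On `Δ(x) = x₁ ⊗ x₂` the two sides are `φ(S(x₂) x₁)` and `φ(x₁ S(x₂))`. This is what makes `(id ⊗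
φ)(e)` central. -/
theorem functional_targetMap_of_trace {φ : B →ₗ[ℂ] ℂ} (h : ∀ x y, φ (x * y) = φ (y * x))
    (x : B) : φ (B.S (B.sourceMap x)) = φ (B.targetMap x) := by
  have key : ∀ t : B ⊗[ℂ] B, φ (B.S (LinearMap.mul' ℂ B (B.S.rTensor B t))) =
      φ (LinearMap.mul' ℂ B (B.S.lTensor B t)) := by
    intro t
    induction t with
    | zero => simp
    | tmul a b => simp [B.S_mul, B.S_S, h a]
    | add s t hs ht => simp only [map_add, hs, ht]
  exact key (B.Δ x)

variable (B) in
/-- The identity `(ε_s ⊗ id) Δ(x) = (1 ⊗ x) e`. -/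
def SourceCompatible : Prop :=
  ∀ x, B.sourceMap.rTensor B (B.Δ x) = ((1 : B) ⊗ₜ[ℂ] x) * B.e

namespace SourceCompatible

theorem S_targetMap_rTensor_Δ (hs : B.SourceCompatible) (x : B) :
    (B.S ∘ₗ B.targetMap).rTensor B (B.Δ x) = B.e * ((1 : B) ⊗ₜ x) := by
  have key : ∀ t : B ⊗[ℂ] B, star (B.sourceMap.rTensor B (star t)) =
      (B.S ∘ₗ B.targetMap).rTensor B t := by
    intro t
    induction t with
    | zero => simp
    | tmul a b => simp [star_sourceMap_star]
    | add s t hs ht => simp only [map_add, star_add, hs, ht]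
  rw [← key, ← map_star B.Δ, hs, star_mul, star_e]
  simp

theorem targetMap_rTensor_Δ (hs : B.SourceCompatible) (x : B) :
    B.targetMap.rTensor B (B.Δ x) = B.S.rTensor B (B.e * ((1 : B) ⊗ₜ x)) := by
  rw [← hs.S_targetMap_rTensor_Δ, ← LinearMap.comp_apply, ← LinearMap.rTensor_comp]
  congr 2
  ext y
  simp [B.S_S]

theorem targetMap_lTensor_Δ (hs : B.SourceCompatible) (x : B) :
    B.targetMap.lTensor B (B.Δ x) = B.e * (x ⊗ₜ (1 : B)) := by
  have key : ∀ t : B ⊗[ℂ] B, B.targetMap.lTensor B t =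
      TensorProduct.map B.S B.S (TensorProduct.comm ℂ B B (B.sourceMap.rTensor B
        (TensorProduct.comm ℂ B B (TensorProduct.map B.S B.S t)))) := by
    intro t
    induction t with
    | zero => simp
    | tmul a b => simp [B.S_S, ← S_targetMap]
    | add s t hs ht => simp only [map_add, hs, ht]
  rw [key, ← Δ_S, hs, comm_mul, comm_e, map_S_mul, map_S_map_S]
  simp [B.S_S, B.S_one]

theorem S_sourceMap_lTensor_Δ (hs : B.SourceCompatible) (x : B) :
    (B.S ∘ₗ B.sourceMap).lTensor B (B.Δ x) = (x ⊗ₜ (1 : B)) * B.e := by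
  have key : ∀ t : B ⊗[ℂ] B, star (B.targetMap.lTensor B (star t)) =
      (B.S ∘ₗ B.sourceMap).lTensor B t := by
    intro t
    induction t with
    | zero => simp
    | tmul a b => simp [star_targetMap_star]
    | add s t hs ht => simp only [map_add, star_add, hs, ht]
  rw [← key, ← map_star B.Δ, hs.targetMap_lTensor_Δ, star_mul, star_e]
  simp

end SourceCompatible

end SourceAxiom

/-! ### Haar invariance versus counital invariance -/

section HaarTrace

/-- Faithfulness makes `y ↦ φ(y ·)` injective (test it on `y^*`), and `M` and its dual have the same
dimension. -/
theorem IsFaithfulTrace.exists_densityFunctional {φ : B →ₗ[ℂ] ℂ} (h : B.IsFaithfulTrace φ)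
    (α : B →ₗ[ℂ] ℂ) : ∃ y, B.densityFunctional φ y = α := by
  let D : B →ₗ[ℂ] Module.Dual ℂ B :=
    { toFun := B.densityFunctional φ
      map_add' := fun x y => by ext z; simp [add_mul]
      map_smul' := fun c y => by ext z; simp }
  have hinj : Function.Injective D := by
    rw [injective_iff_map_eq_zero]
    intro y hy
    by_contra hne
    have h1 := h.pos y hne
    rw [h.trace] at h1
    have h2 : φ (y * star y) = 0 := LinearMap.congr_fun hy (star y)
    exact h1.ne' h2
  exact (LinearMap.injective_iff_surjective_of_finrank_eq_finrank
    (Subspace.dual_finrank_eq (K := ℂ) (V := B)).symm).1 hinj α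

theorem IsFaithfulTrace.densityFunctional_injective {φ : B →ₗ[ℂ] ℂ} (h : B.IsFaithfulTrace φ) :
    Function.Injective (B.densityFunctional φ) := by
  intro x y hxy
  rw [← sub_eq_zero]
  by_contra hne
  have h1 := h.pos _ hne
  rw [h.trace, sub_mul, map_sub] at h1
  have h2 := LinearMap.congr_fun hxy (star (x - y))
  simp only [densityFunctional_apply] at h2
  rw [h2, sub_self] at h1
  exact lt_irrefl _ h1

theorem IsHaarTrace.sourceCompatible {φ : B →ₗ[ℂ] ℂ} (h : B.IsHaarTrace φ) :
    B.SourceCompatible := by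
  intro x
  rw [sourceMap_rTensor_Δ]
  apply eq_of_forall_sliceRight
  intro α
  obtain ⟨y, rfl⟩ := h.exists_densityFunctional α
  -- Invariance moves `y` across in the factor `b`, and anti-multiplicativity pulls `S(a)` inside
  -- `S`. For `t = Δ(x)` the right side then contains `Δ(yx)`, and invariance for the pair `1`, `yx`
  -- finishes.
  have key : ∀ t : B ⊗[ℂ] B, B.sliceRight (B.densityFunctional φ y) (B.antipodeMulΔ t) =
      B.S (B.sliceRight φ (B.Δ y * t)) := by
    intro t
    induction t with
    | zero => simp
    | tmul a b =>
      have ht : (a ⊗ₜ[ℂ] b : B ⊗[ℂ] B) = ((1 : B) ⊗ₜ b) * (a ⊗ₜ (1 : B)) := by simp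
      rw [antipodeMulΔ_tmul, sliceRight_tmul_one_mul, ← sliceRight_one_tmul_mul, h.invariant, ht,
        ← mul_assoc, sliceRight_mul_tmul_one, B.S_mul]
    | add s t hs ht => simp [mul_add, hs, ht]
  have h1 := h.invariant 1 (y * x)
  rw [← Algebra.TensorProduct.one_def, mul_one] at h1
  rw [key, ← map_mul, ← h1, ← sliceRight_one_tmul_mul, ← mul_assoc]
  simp [e]

theorem IsHaarTrace.sliceRight_Δ {φ : B →ₗ[ℂ] ℂ} (h : B.IsHaarTrace φ) (x : B) :
    B.sliceRight φ (B.Δ x) = B.S (B.sliceRight φ (B.e * ((1 : B) ⊗ₜ x))) := by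
  have h1 := h.invariant x 1
  rwa [← Algebra.TensorProduct.one_def, one_mul] at h1

theorem IsHaarTrace.isCounitalHaarTrace {φ : B →ₗ[ℂ] ℂ} (h : B.IsHaarTrace φ) :
    B.IsCounitalHaarTrace φ where
  toIsFaithfulTrace := h.toIsFaithfulTrace
  comp_S := h.comp_S
  invariant x := by
    rw [h.sourceCompatible.targetMap_rTensor_Δ, sliceRight_rTensor, h.sliceRight_Δ]

theorem IsCounitalHaarTrace.isHaarTrace {φ : B →ₗ[ℂ] ℂ} (h : B.IsCounitalHaarTrace φ)
    (hs : B.SourceCompatible) : B.IsHaarTrace φ where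
  toIsFaithfulTrace := h.toIsFaithfulTrace
  comp_S := h.comp_S
  invariant x y := by
    have h0 : ∀ z, B.sliceRight φ (B.Δ z) = B.S (B.sliceRight φ (B.e * ((1 : B) ⊗ₜ z))) := by
      intro z
      rw [h.invariant, hs.targetMap_rTensor_Δ, sliceRight_rTensor]
    -- The source identity rewrites `(1 ⊗ y) Δ(x) = (1 ⊗ y) e Δ(x)` as `(S(y₁) ⊗ 1) Δ(y₂ x)`, so
    -- invariance is only needed in the form `h0`, where no `y` occurs.
    have key : ∀ t : B ⊗[ℂ] B, B.sliceRight φ (B.antipodeMulΔ t * B.Δ x) =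
        B.S (B.sliceRight φ (B.e * t * ((1 : B) ⊗ₜ x))) := by
      intro t
      induction t with
      | zero => simp
      | tmul a b =>
        have ht : (a ⊗ₜ[ℂ] b : B ⊗[ℂ] B) * ((1 : B) ⊗ₜ x) =
          ((1 : B) ⊗ₜ (b * x)) * (a ⊗ₜ (1 : B)) := by simp
        rw [antipodeMulΔ_tmul, mul_assoc, ← map_mul, sliceRight_tmul_one_mul, h0, mul_assoc, ht,
          ← mul_assoc, sliceRight_mul_tmul_one, B.S_mul]
      | add s t hs ht => simp [mul_add, add_mul, hs, ht]
    rw [← e_mul_Δ, ← mul_assoc, ← hs y, sourceMap_rTensor_Δ, key, e_mul_Δ]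

end HaarTrace

/-! ### A unit of the dual algebra is a weak Kac counit -/

section DualUnit

theorem IsDualUnit.counit_left {ε : B →ₗ[ℂ] ℂ} (h : B.IsDualUnit ε) (x : B) :
    B.sliceLeft ε (B.Δ x) = x :=
  B.eq_of_forall_functional fun α => by
    rw [← tensorFunctional_eq_right, ← dualMul_apply, (h α).1]

theorem IsDualUnit.counit_right {ε : B →ₗ[ℂ] ℂ} (h : B.IsDualUnit ε) (x : B) :
    B.sliceRight ε (B.Δ x) = x :=
  B.eq_of_forall_functional fun α => by
    rw [← tensorFunctional_eq_left, ← dualMul_apply, (h α).2]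

theorem IsDualUnit.unique {ε ε' : B →ₗ[ℂ] ℂ} (h : B.IsDualUnit ε) (h' : B.IsDualUnit ε') :
    ε = ε' := by
  rw [← (h' ε).1, (h ε').2]

theorem comp_S_comp_S (α : B →ₗ[ℂ] ℂ) : (α ∘ₗ B.S) ∘ₗ B.S = α := by
  ext x
  simp [B.S_S]

/-- Composition with `S` reverses the dual product, so it carries a unit to a unit, and units are
unique. -/
theorem IsDualUnit.comp_S {ε : B →ₗ[ℂ] ℂ} (h : B.IsDualUnit ε) : ε ∘ₗ B.S = ε := by
  refine IsDualUnit.unique (fun α => ?_) h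
  rw [← B.comp_S_comp_S α, dualMul_comp_S, dualMul_comp_S, (h _).1, (h _).2]
  exact ⟨rfl, rfl⟩

/-- The functional `x ↦ conj (α (x^*))`. -/
noncomputable def conjFunctional (α : B →ₗ[ℂ] ℂ) : B →ₗ[ℂ] ℂ where
  toFun x := star (α (star x))
  map_add' x y := by simp
  map_smul' c x := by simp

@[simp]
theorem conjFunctional_apply (α : B →ₗ[ℂ] ℂ) (x : B) :
    conjFunctional α x = star (α (star x)) := rfl

theorem conjFunctional_conjFunctional (α : B →ₗ[ℂ] ℂ) :
    conjFunctional (conjFunctional α) = α := by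
  ext x
  simp

theorem tensorFunctional_conjFunctional (α β : B →ₗ[ℂ] ℂ) (t : B ⊗[ℂ] B) :
    B.tensorFunctional (conjFunctional α) (conjFunctional β) t =
      star (B.tensorFunctional α β (star t)) := by
  induction t with
  | zero => simp
  | tmul a b => simp
  | add s t hs ht => simp only [map_add, star_add, hs, ht]

theorem dualMul_conjFunctional (α β : B →ₗ[ℂ] ℂ) :
    B.dualMul (conjFunctional α) (conjFunctional β) = conjFunctional (B.dualMul α β) := by
  ext x
  simp only [dualMul_apply, tensorFunctional_conjFunctional, conjFunctional_apply, map_star]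

theorem IsDualUnit.conjFunctional {ε : B →ₗ[ℂ] ℂ} (h : B.IsDualUnit ε) :
    conjFunctional ε = ε := by
  refine IsDualUnit.unique (fun α => ?_) h
  rw [← conjFunctional_conjFunctional α, dualMul_conjFunctional, dualMul_conjFunctional,
    (h _).1, (h _).2]
  exact ⟨rfl, rfl⟩

theorem IsHaarTrace.isWeakKac {φ : B →ₗ[ℂ] ℂ} (h : B.IsHaarTrace φ) {y : B}
    (hy : B.IsDualUnit (B.densityFunctional φ y)) : B.IsWeakKac (B.densityFunctional φ y) := by
  set ε := B.densityFunctional φ y with hε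
  have hstar : ∀ x, ε (star x) = star (ε x) := fun x => by
    conv_lhs => rw [← hy.conjFunctional]
    simp
  -- As `ε(x ·) = φ(yx ·)`, invariance produces `Δ(yx) = Δ(y) Δ(x)`. A second use, on `Δ(y)` alone,
  -- together with the counit property leaves `S(x₁) x₂ z`.
  have hsm : ∀ x z, B.sliceRight (B.densityFunctional ε x) (B.Δ z) = B.sourceMap x * z := by
    intro x z
    have key : ∀ t : B ⊗[ℂ] B, B.S (B.sliceRight φ (B.Δ y * t * ((1 : B) ⊗ₜ z))) =
        LinearMap.mul' ℂ B (B.S.rTensor B t) * z := by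
      intro t
      induction t with
      | zero => simp
      | tmul a b =>
        have ht : (a ⊗ₜ[ℂ] b : B ⊗[ℂ] B) * ((1 : B) ⊗ₜ z) =
          ((1 : B) ⊗ₜ (b * z)) * (a ⊗ₜ (1 : B)) := by simp
        rw [mul_assoc, ht, ← mul_assoc, sliceRight_mul_tmul_one, B.S_mul, ← h.invariant,
          sliceRight_one_tmul_mul, ← hε, hy.counit_right]
        simp [mul_assoc]
      | add s t hs ht => simp only [mul_add, add_mul, map_add, hs, ht]
    have hd : B.densityFunctional ε x = B.densityFunctional φ (y * x) := by
      ext w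
      simp [hε, mul_assoc]
    rw [hd, ← sliceRight_one_tmul_mul, h.invariant, map_mul B.Δ, key]
    rfl
  have hmul : ∀ x z, B.tensorFunctional ε (B.densityFunctional ε x) (B.e * (z ⊗ₜ (1 : B))) =
      ε (x * z) := by
    intro x z
    rw [tensorFunctional_eq_left, sliceRight_mul_tmul_one, e, hsm, mul_one, ← hsm,
      ← tensorFunctional_eq_left, tensorFunctional_eq_right, hy.counit_left]
    rfl
  have htf : ∀ x (t : B ⊗[ℂ] B), B.tensorFunctional ε (B.densityFunctional ε x) t =
      B.tensorFunctional ε ε (((1 : B) ⊗ₜ x) * t) := by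
    intro x t
    rw [tensorFunctional_eq_left, tensorFunctional_eq_left, sliceRight_one_tmul_mul]
  exact
    { counit_left := hy.counit_left
      counit_right := hy.counit_right
      counit_S := fun x => LinearMap.congr_fun hy.comp_S x
      counit_star := hstar
      source := h.sourceCompatible
      counit_mul := fun x z => by
        -- `hmul` has the legs of `e` multiplied on the opposite sides from the axiom; since `e` is
        -- self-adjoint and `ε` is Hermitian, taking adjoints exchanges the two.
        have h1 := hmul (star z) (star x)
        rw [htf, ← star_mul, hstar, ← mul_assoc] at h1
        have h2 := B.tensorFunctional_conjFunctional ε ε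
          ((x ⊗ₜ[ℂ] (1 : B)) * B.e * ((1 : B) ⊗ₜ[ℂ] z))
        rw [hy.conjFunctional] at h2
        rw [h2, star_mul, star_mul, star_e]
        simp only [TensorProduct.star_tmul, star_one]
        rw [← mul_assoc, h1, star_star] }

end DualUnit

end CoinvBialg
-- The Hilbert space structure of a faithful trace
/-- A positive definite Hermitian form on a finite-dimensional complex space has an orthonormal
basis. -/
theorem InnerProductSpace.Core.exists_orthonormal_basis {E : Type*} [AddCommGroup E] [Module ℂ E]
    [FiniteDimensional ℂ E] (c : InnerProductSpace.Core ℂ E) :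
    ∃ b : Module.Basis (Fin (Module.finrank ℂ E)) ℂ E,
      ∀ i j, c.inner (b i) (b j) = if i = j then 1 else 0 := by
  let := c.toNormedAddCommGroup
  let : InnerProductSpace ℂ E := InnerProductSpace.ofCore c.toCore
  refine ⟨(stdOrthonormalBasis ℂ E).toBasis, fun i j => ?_⟩
  have h := orthonormal_iff_ite.1 (stdOrthonormalBasis ℂ E).orthonormal i j
  rw [OrthonormalBasis.coe_toBasis]
  exact h

namespace CoinvBialg

variable {B : CoinvBialg.{u}}

section Positivity

namespace IsFaithfulTrace

variable {φ : B →ₗ[ℂ] ℂ}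

theorem nonneg (h : B.IsFaithfulTrace φ) (x : B) : 0 ≤ φ (star x * x) := by
  by_cases hx : x = 0
  · simp [hx]
  · exact (h.pos x hx).le

theorem map_star (h : B.IsFaithfulTrace φ) (x : B) : φ (star x) = star (φ x) := by
  have h1 : ∀ y : B, star (φ (star y * y)) = φ (star y * y) := fun y =>
    Complex.conj_eq_iff_im.2 (Complex.le_def.1 (h.nonneg y)).2.symm
  -- Polarization: the values of `φ(y^* y)` at `x + 1` and `x + i` are real, which gives the real
  -- and imaginary parts of the claim.
  have e1 := h1 (x + 1)
  have e2 := h1 (x + Complex.I • (1 : B))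
  have e3 := h1 x
  have e4 := h1 1
  simp only [star_add, star_one, star_smul, add_mul, mul_add, mul_one, one_mul, map_add,
    smul_mul_assoc, mul_smul_comm, map_smul, smul_eq_mul, RCLike.star_def, Complex.conj_I,
    map_mul, map_neg] at e1 e2 e3 e4
  rw [e3, e4] at e1 e2
  have e5 : Complex.I * (starRingEnd ℂ (φ x) - φ (star x)) * 2 = 0 := by
    linear_combination Complex.I * e1 + e2
  simp only [mul_eq_zero, Complex.I_ne_zero, false_or, OfNat.ofNat_ne_zero, or_false] at e5
  exact (sub_eq_zero.1 e5).symm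

theorem star_sliceRight (h : B.IsFaithfulTrace φ) (t : B ⊗[ℂ] B) :
    star (B.sliceRight φ t) = B.sliceRight φ (star t) := by
  induction t with
  | zero => simp
  | tmul a b => simp [h.map_star]
  | add s t hs ht => simp only [map_add, star_add, hs, ht]

/-- The inner product `⟪x, y⟫ = φ(x^* y)` of a faithful trace. -/
@[reducible]
noncomputable def innerCore (h : B.IsFaithfulTrace φ) : InnerProductSpace.Core ℂ B where
  inner x y := φ (star x * y)
  conj_inner_symm x y := by
    change star (φ (star y * x)) = φ (star x * y)
    rw [← h.map_star, star_mul, star_star]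
  re_inner_nonneg x := (Complex.le_def.1 (h.nonneg x)).1
  add_left x y z := by simp [add_mul]
  smul_left x y r := by simp
  definite x hx := by
    by_contra hne
    exact (h.pos x hne).ne' hx

theorem exists_orthonormal_basis (h : B.IsFaithfulTrace φ) :
    ∃ b : Module.Basis (Fin (Module.finrank ℂ B)) ℂ B,
      ∀ i j, φ (star (b i) * b j) = if i = j then 1 else 0 :=
  h.innerCore.exists_orthonormal_basis

/-- Writing `t = ∑ xᵢ ⊗ bᵢ` over an orthonormal basis turns the value into `∑ φ(xᵢ^* xᵢ)`. -/
theorem sliceRight_star_mul_self_pos (h : B.IsFaithfulTrace φ) {t : B ⊗[ℂ] B} (ht : t ≠ 0) :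
    0 < φ (B.sliceRight φ (star t * t)) := by
  obtain ⟨b, hb⟩ := h.exists_orthonormal_basis
  obtain ⟨x, hx⟩ : ∃ x : Fin (Module.finrank ℂ B) → B, t = ∑ i, x i ⊗ₜ[ℂ] b i := by
    clear ht
    induction t with
    | zero => exact ⟨0, by simp⟩
    | tmul y z =>
      refine ⟨fun i => b.repr z i • y, ?_⟩
      simp only [TensorProduct.smul_tmul]
      rw [← TensorProduct.tmul_sum, b.sum_repr]
    | add s t hs ht =>
      obtain ⟨x, rfl⟩ := hs
      obtain ⟨y, rfl⟩ := ht
      exact ⟨x + y, by simp [TensorProduct.add_tmul, Finset.sum_add_distrib]⟩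
  have key : φ (B.sliceRight φ (star t * t)) = ∑ i, φ (star (x i) * x i) := by
    rw [hx]
    simp [Finset.sum_mul, Finset.mul_sum, hb]
  rw [key]
  refine Finset.sum_pos' (fun i _ => h.nonneg _) ?_
  by_contra! hall
  refine ht ?_
  rw [hx]
  refine Finset.sum_eq_zero fun i hi => ?_
  have hxi : x i = 0 := by
    by_contra hne
    exact hall i hi (h.pos _ hne)
  rw [hxi, TensorProduct.zero_tmul]

/-- With `g` the adjoint of `f`, the trace of `g f` is the squared Hilbert–Schmidt norm of `f`. -/
theorem trace_adjoint_mul_self_eq_zero (h : B.IsFaithfulTrace φ) {f g : B →ₗ[ℂ] B}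
    (hfg : ∀ x y, φ (star (f x) * y) = φ (star x * g y)) (h0 : LinearMap.trace ℂ B (g ∘ₗ f) = 0) :
    f = 0 := by
  obtain ⟨b, hb⟩ := h.exists_orthonormal_basis
  have hrepr : ∀ x i, b.repr x i = φ (star (b i) * x) := by
    intro x i
    conv_rhs => rw [← b.sum_repr x, Finset.mul_sum, map_sum]
    simp only [mul_smul_comm, map_smul, hb, smul_eq_mul]
    simp
  have htr : LinearMap.trace ℂ B (g ∘ₗ f) = ∑ i, φ (star (f (b i)) * f (b i)) := by
    rw [LinearMap.trace_eq_matrix_trace ℂ b, Matrix.trace]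
    refine Finset.sum_congr rfl fun i _ => ?_
    rw [Matrix.diag_apply, LinearMap.toMatrix_apply, hrepr, hfg]
    rfl
  rw [htr, Finset.sum_eq_zero_iff_of_nonneg (fun i _ => h.nonneg _)] at h0
  refine b.ext fun i => ?_
  by_contra hne
  exact (h.pos _ hne).ne' (h0 i (Finset.mem_univ i))

end IsFaithfulTrace

end Positivity

/-! ### Existence of the dual unit via a nondegenerate trace form -/

section DualUnitExistence

variable (B) in
/-- The operator `x ↦ (α ⊗ id) Δ(x)`. -/
noncomputable def leftOp (α : B →ₗ[ℂ] ℂ) : B →ₗ[ℂ] B := B.sliceLeft α ∘ₗ B.ΔLin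

theorem leftOp_apply (α : B →ₗ[ℂ] ℂ) (x : B) : B.leftOp α x = B.sliceLeft α (B.Δ x) := rfl

theorem comp_leftOp (α β : B →ₗ[ℂ] ℂ) : β ∘ₗ B.leftOp α = B.dualMul α β := by
  ext x
  rw [dualMul_apply, tensorFunctional_eq_right]
  rfl

theorem leftOp_comp_leftOp (α β : B →ₗ[ℂ] ℂ) :
    B.leftOp β ∘ₗ B.leftOp α = B.leftOp (B.dualMul α β) := by
  ext x
  refine B.eq_of_forall_functional fun γ => ?_
  have h : (γ ∘ₗ B.leftOp β) ∘ₗ B.leftOp α = γ ∘ₗ B.leftOp (B.dualMul α β) := by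
    rw [comp_leftOp, comp_leftOp, comp_leftOp, dualMul_assoc]
  exact LinearMap.congr_fun h x

variable (B) in
/-- The linear structure of `leftOp`. -/
noncomputable def leftOpLin : (B →ₗ[ℂ] ℂ) →ₗ[ℂ] (B →ₗ[ℂ] B) where
  toFun := B.leftOp
  map_add' α β := by
    ext x
    simp only [leftOp_apply, LinearMap.add_apply]
    induction B.Δ x with
    | zero => simp
    | tmul a b => simp [add_smul]
    | add s t hs ht => simp only [map_add, hs, ht]; abel
  map_smul' c α := by
    ext x
    simp only [leftOp_apply, LinearMap.smul_apply, RingHom.id_apply]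
    induction B.Δ x with
    | zero => simp
    | tmul a b => simp [mul_smul]
    | add s t hs ht => simp only [map_add, hs, ht, smul_add]

@[simp]
theorem leftOpLin_apply (α : B →ₗ[ℂ] ℂ) : B.leftOpLin α = B.leftOp α := rfl

namespace IsHaarTrace

variable {φ : B →ₗ[ℂ] ℂ}

theorem functional_mul_leftOp (h : B.IsHaarTrace φ) (α : B →ₗ[ℂ] ℂ) (x y : B) :
    φ (y * B.leftOp α x) = φ (B.leftOp (α ∘ₗ B.S) y * x) := by
  have h1 := congrArg α (h.invariant x y)
  rw [← tensorFunctional_eq_left, tensorFunctional_eq_right, sliceLeft_one_tmul_mul] at h1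
  rw [leftOp_apply, h1, ← LinearMap.comp_apply, ← tensorFunctional_eq_left,
    tensorFunctional_eq_right, sliceLeft_mul_one_tmul]
  rfl

theorem sliceLeft_conjFunctional_star (α : B →ₗ[ℂ] ℂ) (t : B ⊗[ℂ] B) :
    B.sliceLeft (CoinvBialg.conjFunctional α) (star t) = star (B.sliceLeft α t) := by
  induction t with
  | zero => simp
  | tmul a b => simp
  | add s t hs ht => simp only [map_add, star_add, hs, ht]

/-- Identifies the adjoint of `L_α`: the family of these operators is closed under adjoints. -/
theorem functional_star_leftOp_mul (h : B.IsHaarTrace φ) (α : B →ₗ[ℂ] ℂ) (x y : B) :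
    φ (star (B.leftOp α x) * y) =
      φ (star x * B.leftOp (CoinvBialg.conjFunctional α ∘ₗ B.S) y) := by
  rw [h.functional_mul_leftOp, comp_S_comp_S, leftOp_apply, leftOp_apply, map_star B.Δ,
    sliceLeft_conjFunctional_star]

/-- Let `α ∘ S = φ(y ·)`. If `L_α = 0`, then `β (α ∘ S) = 0` for all `β`; moving `L_β` across `φ`
gives `L_β y = 0` for all `β`. So `Δ(y) = 0`, and injectivity of `Δ` gives `y = 0`. -/
theorem leftOpLin_injective (h : B.IsHaarTrace φ) : Function.Injective B.leftOpLin := by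
  rw [injective_iff_map_eq_zero]
  intro α hα
  obtain ⟨y, hy⟩ := h.exists_densityFunctional (α ∘ₗ B.S)
  have hβ : ∀ β : B →ₗ[ℂ] ℂ, B.leftOp β y = 0 := by
    intro β
    apply h.densityFunctional_injective
    ext x
    have h1 : B.dualMul ((β ∘ₗ B.S) ∘ₗ B.S ∘ₗ B.S) (α ∘ₗ B.S) = 0 := by
      rw [← LinearMap.comp_assoc, dualMul_comp_S, ← comp_leftOp, ← leftOpLin_apply, hα,
        LinearMap.comp_zero, LinearMap.zero_comp]
    rw [← LinearMap.comp_assoc, comp_S_comp_S, ← hy, ← comp_leftOp] at h1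
    have h2 := LinearMap.congr_fun h1 x
    rw [LinearMap.comp_apply, densityFunctional_apply, h.functional_mul_leftOp,
      comp_S_comp_S] at h2
    simpa using h2
  have hy0 : y = 0 := by
    apply B.Δ_injective
    rw [map_zero]
    apply (TensorProduct.comm ℂ B B).injective
    apply eq_of_forall_sliceRight
    intro β
    rw [map_zero, map_zero, ← sliceLeft_comm, comm_comm]
    exact hβ β
  rw [← B.comp_S_comp_S α, ← hy, hy0]
  ext x
  simp

theorem exists_isDualUnit (h : B.IsHaarTrace φ) : ∃ ε : B →ₗ[ℂ] ℂ, B.IsDualUnit ε := by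
  let T := LinearMap.trace ℂ B
  let D : (B →ₗ[ℂ] ℂ) →ₗ[ℂ] (B →ₗ[ℂ] ℂ) →ₗ[ℂ] ℂ :=
    LinearMap.mk₂ ℂ (fun u α => T (B.leftOpLin α ∘ₗ B.leftOpLin u))
      (fun _ _ _ => by simp only [map_add, LinearMap.comp_add])
      (fun _ _ _ => by simp only [map_smul, LinearMap.comp_smul])
      (fun _ _ _ => by simp only [map_add, LinearMap.add_comp])
      (fun _ _ _ => by simp only [map_smul, LinearMap.smul_comp])
  have hD : ∀ u α, D u α = T (B.leftOp α ∘ₗ B.leftOp u) := fun _ _ => rfl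
  have hinj : Function.Injective D := by
    rw [injective_iff_map_eq_zero]
    intro u hu
    apply h.leftOpLin_injective
    rw [map_zero]
    exact h.trace_adjoint_mul_self_eq_zero (h.functional_star_leftOp_mul u)
      (LinearMap.congr_fun hu _)
  obtain ⟨u, hu⟩ := (LinearMap.injective_iff_surjective_of_finrank_eq_finrank
    (Subspace.dual_finrank_eq (K := ℂ) (V := B →ₗ[ℂ] ℂ)).symm).1 hinj (T ∘ₗ B.leftOpLin)
  have hu' : ∀ α, T (B.leftOp α ∘ₗ B.leftOp u) = T (B.leftOp α) := LinearMap.congr_fun hu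
  -- Each unit law is tested against the nondegenerate form `D`; there it reduces to `Tr(L_γ L_u) =
  -- Tr L_γ` with `γ` a product of `α` and `β`, by cyclicity for the right unit law.
  refine ⟨u, fun α => ⟨hinj ?_, hinj ?_⟩⟩ <;> ext β <;> rw [hD, hD]
  · rw [← leftOp_comp_leftOp, ← LinearMap.comp_assoc, leftOp_comp_leftOp, hu']
  · rw [← leftOp_comp_leftOp, ← LinearMap.comp_assoc, LinearMap.trace_comp_comm',
      ← LinearMap.comp_assoc, leftOp_comp_leftOp, hu', ← leftOp_comp_leftOp,
      LinearMap.trace_comp_comm']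

end IsHaarTrace

end DualUnitExistence

/-! ### Uniqueness and existence of the normalized Haar trace -/

section Normalization

variable {φ ψ : B →ₗ[ℂ] ℂ}

theorem IsNormalized.sliceLeft_e (h : B.IsNormalized φ) (hS : ∀ x, φ (B.S x) = φ x) :
    B.sliceLeft φ B.e = 1 := by
  have h1 := B.sliceRight_comm_map_S φ B.e
  have h2 : φ ∘ₗ B.S = φ := LinearMap.ext hS
  have h3 : TensorProduct.comm ℂ B B (TensorProduct.map B.S B.S B.e) = B.e := by
    rw [← comm_e, comm_comm]
  rw [h3, h2] at h1
  rw [IsNormalized, h1] at h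
  rw [← B.S_S (B.sliceLeft φ B.e), h, B.S_one]

theorem IsHaarTrace.dualMul_eq_right (hψ : B.IsHaarTrace ψ) (hφ : B.IsNormalized φ)
    (hS : ∀ x, φ (B.S x) = φ x) : B.dualMul φ ψ = ψ := by
  ext x
  rw [dualMul_apply, tensorFunctional_eq_left, hψ.sliceRight_Δ, hS, ← tensorFunctional_eq_left,
    tensorFunctional_eq_right, sliceLeft_mul_one_tmul, hφ.sliceLeft_e hS, one_mul]

/-- Absorption gives `φψ = ψ` and `ψφ = φ`. Composing with `S` reverses products and fixes both
traces, so also `φψ = φ`. -/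
theorem IsHaarTrace.eq_of_isNormalized (hφ : B.IsHaarTrace φ) (hψ : B.IsHaarTrace ψ)
    (hφ' : B.IsNormalized φ) (hψ' : B.IsNormalized ψ) : φ = ψ := by
  have h1 := hψ.dualMul_eq_right hφ' hφ.comp_S
  have h2 := hφ.dualMul_eq_right hψ' hψ.comp_S
  have h3 := B.dualMul_comp_S φ ψ
  have hφS : φ ∘ₗ B.S = φ := LinearMap.ext hφ.comp_S
  have hψS : ψ ∘ₗ B.S = ψ := LinearMap.ext hψ.comp_S
  rw [h2, hφS, hψS, h1] at h3
  exact h3.symm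

theorem sliceRight_e_mul_comm (hs : B.SourceCompatible) (h : ∀ x y, φ (x * y) = φ (y * x))
    (x : B) : x * B.sliceRight φ B.e = B.sliceRight φ B.e * x := by
  rw [← sliceRight_tmul_one_mul, ← hs.S_sourceMap_lTensor_Δ, sliceRight_lTensor,
    ← sliceRight_mul_tmul_one, ← hs.targetMap_lTensor_Δ, sliceRight_lTensor]
  congr 1
  congr 1
  ext y
  exact functional_targetMap_of_trace h y

theorem IsHaarTrace.targetMap_sliceRight_Δ (h : B.IsHaarTrace φ) (x : B) :
    B.targetMap (B.sliceRight φ (B.Δ x)) = B.sliceRight φ (B.Δ x) := by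
  rw [← sliceRight_rTensor, ← h.isCounitalHaarTrace.invariant]

/-- Coassociativity writes the left side as `(id ⊗ (id ⊗ φ)Δ)(e)`; the range of `(id ⊗ φ)Δ` is fixed
by `ε_t`, so applying `id ⊗ ε_t` changes nothing. -/
theorem IsHaarTrace.Δ_sliceRight_e (h : B.IsHaarTrace φ) :
    B.Δ (B.sliceRight φ B.e) = B.e * (B.sliceRight φ B.e ⊗ₜ (1 : B)) := by
  have h1 : B.targetMap ∘ₗ B.sliceRight φ ∘ₗ B.ΔLin = B.sliceRight φ ∘ₗ B.ΔLin :=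
    LinearMap.ext h.targetMap_sliceRight_Δ
  rw [← h.sourceCompatible.targetMap_lTensor_Δ]
  conv_rhs => rw [e, Δ_sliceRight_Δ]
  rw [← LinearMap.comp_apply, ← LinearMap.lTensor_comp, h1, e, Δ_sliceRight_Δ]

theorem IsHaarTrace.exists_isNormalized (h : B.IsHaarTrace φ) {ε : B →ₗ[ℂ] ℂ}
    (hε : B.IsDualUnit ε) : ∃ ψ : B →ₗ[ℂ] ℂ, B.IsHaarTrace ψ ∧ B.IsNormalized ψ := by
  set n := B.sliceRight φ B.e with hn
  have hcomm : ∀ x, x * n = n * x := sliceRight_e_mul_comm h.sourceCompatible h.trace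
  have hSn : B.S n = n := by
    have h1 := h.invariant 1 1
    rw [← Algebra.TensorProduct.one_def, one_mul, mul_one] at h1
    exact h1.symm
  -- This number is the squared norm of `e (y ⊗ 1)` under `φ ⊗ φ`, and that tensor is nonzero
  -- because `id ⊗ ε` sends it to `y`.
  have hpos : ∀ y, y ≠ 0 → 0 < φ (n * (star y * y)) := by
    intro y hy
    have hne : B.e * (y ⊗ₜ[ℂ] (1 : B)) ≠ 0 := by
      intro h0
      have h1 := congrArg (B.sliceRight ε) h0
      rw [sliceRight_mul_tmul_one, e, hε.counit_right, one_mul, map_zero] at h1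
      exact hy h1
    have h1 := h.sliceRight_star_mul_self_pos hne
    have h2 : B.e * B.e = B.e := e_mul_Δ B 1
    rw [star_mul, star_e, mul_assoc, ← mul_assoc B.e, h2, TensorProduct.star_tmul, star_one,
      sliceRight_tmul_one_mul, sliceRight_mul_tmul_one, ← hn, ← hcomm, ← mul_assoc, hcomm] at h1
    exact h1
  obtain ⟨m, hm⟩ : ∃ m, n * m = 1 := by
    have hinj : Function.Injective (LinearMap.mulLeft ℂ n) := by
      rw [injective_iff_map_eq_zero]
      intro y hy
      by_contra hne
      have h1 := hpos (star y) (star_ne_zero.2 hne)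
      rw [star_star, ← mul_assoc, ← LinearMap.mulLeft_apply ℂ n y, hy, zero_mul, map_zero] at h1
      exact lt_irrefl _ h1
    exact LinearMap.injective_iff_surjective.1 hinj 1
  have hm' : m * n = 1 := by rw [hcomm, hm]
  have hmcomm : ∀ x, x * m = m * x := fun x => by
    calc x * m = m * n * (x * m) := by rw [hm', one_mul]
      _ = m * (x * n) * m := by rw [hcomm x]; simp only [mul_assoc]
      _ = m * x * (n * m) := by simp only [mul_assoc]
      _ = m * x := by rw [hm, mul_one]
  have hSm : B.S m = m := by
    have h1 : n * B.S m = 1 := by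
      have h2 := B.S_mul m n
      rw [hm', B.S_one, hSn] at h2
      exact h2.symm
    calc B.S m = m * n * B.S m := by rw [hm', one_mul]
      _ = m := by rw [mul_assoc, h1, mul_one]
  have hΔm : B.Δ m = B.e * (m ⊗ₜ[ℂ] (1 : B)) := by
    have h1 : B.Δ m * (n ⊗ₜ[ℂ] (1 : B)) = B.e := by
      rw [← Δ_mul_e, mul_assoc, ← h.Δ_sliceRight_e, ← map_mul, ← hn, hm', e]
    rw [← h1, mul_assoc, Algebra.TensorProduct.tmul_mul_tmul, hm, one_mul,
      ← Algebra.TensorProduct.one_def, mul_one]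
  have hΔm' : B.Δ m = ((1 : B) ⊗ₜ[ℂ] m) * B.e := by
    rw [← hSm, Δ_S, hΔm, map_S_mul, comm_mul, ← comm_e, comm_comm]
    simp [B.S_one]
  -- Here `m = n⁻¹` is central and `S`-fixed, and `Δ(m)` equals both `e (m ⊗ 1)` and `(1 ⊗ m) e`:
  -- the second form transfers invariance, and comparing the two gives the normalization `n m = 1`.
  refine ⟨B.densityFunctional φ m, { trace := ?_, pos := ?_, comp_S := ?_, invariant := ?_ }, ?_⟩
  · intro x y
    simp only [densityFunctional_apply]
    rw [← mul_assoc, h.trace, ← mul_assoc, hmcomm, mul_assoc]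
  · intro x hx
    have hmx : m * x ≠ 0 := fun h0 => hx (by rw [← one_mul x, ← hm, mul_assoc, h0, mul_zero])
    have hsm : star m = m := by
      have hsn : star n = n := by
        rw [hn, h.star_sliceRight, star_e]
      have h1 : n * star m = 1 := by rw [← hsn, ← star_mul, hm', star_one]
      calc star m = m * n * star m := by rw [hm', one_mul]
        _ = m := by rw [mul_assoc, h1, mul_one]
    have h1 := hpos _ hmx
    rw [star_mul, hsm, hmcomm, mul_assoc, ← mul_assoc n, hm, one_mul, ← mul_assoc, hmcomm,
      mul_assoc] at h1
    exact h1
  · intro x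
    simp only [densityFunctional_apply]
    rw [← hSm, ← B.S_mul, h.comp_S, hSm, hmcomm]
  · intro x y
    rw [← sliceRight_one_tmul_mul, ← sliceRight_one_tmul_mul, ← mul_assoc,
      Algebra.TensorProduct.tmul_mul_tmul, one_mul, h.invariant, map_mul B.Δ, hΔm', mul_assoc _ B.e,
      e_mul_Δ, mul_assoc]
  · rw [IsNormalized, ← sliceRight_one_tmul_mul, ← hΔm', hΔm, sliceRight_mul_tmul_one, ← hn, hm]

end Normalization

end CoinvBialg
-- Positivity of the regular trace
section RegularTrace

variable {A : Type*} [CStarAlgebra A]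

theorem CStarAlgebra.nonneg_of_mem_spectrum_star_mul_self {x : A} {c : ℂ}
    (hc : c ∈ spectrum ℂ (star x * x)) : 0 ≤ c := by
  have hre : c = c.re := IsSelfAdjoint.mem_spectrum_eq_re (IsSelfAdjoint.star_mul_self x) hc
  rw [hre] at hc ⊢
  have h : c.re ∈ spectrum ℝ (star x * x) := (spectrum.algebraMap_mem_iff ℂ).1 hc
  exact Complex.zero_le_real.2 (spectrum_star_mul_self_nonneg _ h)

theorem LinearMap.hasEigenvalue_mulLeft_iff [FiniteDimensional ℂ A] {a : A} {c : ℂ} :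
    Module.End.HasEigenvalue (LinearMap.mulLeft ℂ a) c ↔ c ∈ spectrum ℂ a := by
  have hmul : ∀ b, LinearMap.mulLeft ℂ (algebraMap ℂ A c - a) b =
      c • b - LinearMap.mulLeft ℂ a b := fun b => by
    simp [sub_mul, Algebra.algebraMap_eq_smul_one]
  rw [spectrum.mem_iff]
  constructor
  · intro h hu
    obtain ⟨b, hb⟩ := h.exists_hasEigenvector
    refine hb.2 (hu.mul_left_cancel ?_)
    rw [mul_zero, ← LinearMap.mulLeft_apply ℂ, hmul, hb.apply_eq_smul, sub_self]
  · contrapose!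
    intro h
    have hinj : Function.Injective (LinearMap.mulLeft ℂ (algebraMap ℂ A c - a)) := by
      rw [injective_iff_map_eq_zero]
      intro b hb
      by_contra hne
      rw [hmul, sub_eq_zero] at hb
      exact h (Module.End.hasEigenvalue_of_hasEigenvector
        (Module.End.hasEigenvector_iff.2 ⟨Module.End.mem_eigenspace_iff.2 hb.symm, hne⟩))
    obtain ⟨b, hb⟩ := LinearMap.injective_iff_surjective.1 hinj 1
    rw [LinearMap.mulLeft_apply] at hb
    refine ⟨⟨_, b, hb, hinj ?_⟩, rfl⟩
    rw [LinearMap.mulLeft_apply, LinearMap.mulLeft_apply, ← mul_assoc, hb, one_mul, mul_one]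

/-- The trace is a sum of eigenvalues, which lie in the nonnegative spectrum of `x^* x`. If the sum
vanished, this self-adjoint element would have spectral radius, hence norm, zero. -/
theorem LinearMap.trace_mulLeft_star_mul_self_pos [FiniteDimensional ℂ A] {x : A} (hx : x ≠ 0) :
    0 < LinearMap.trace ℂ A (LinearMap.mulLeft ℂ (star x * x)) := by
  have hroot : ∀ c, c ∈ (LinearMap.mulLeft ℂ (star x * x)).charpoly.roots ↔
      c ∈ spectrum ℂ (star x * x) := fun c => by
    rw [← hasEigenvalue_mulLeft_iff, Module.End.hasEigenvalue_iff_isRoot_charpoly,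
      Polynomial.mem_roots (LinearMap.charpoly_monic _).ne_zero]
  have hnn : ∀ c ∈ (LinearMap.mulLeft ℂ (star x * x)).charpoly.roots, 0 ≤ c := fun c hc =>
    CStarAlgebra.nonneg_of_mem_spectrum_star_mul_self ((hroot c).1 hc)
  rw [Module.End.trace_eq_sum_roots_charpoly_of_splits (IsAlgClosed.splits _)]
  refine lt_of_le_of_ne (Multiset.sum_nonneg hnn) fun h0 => hx ?_
  have hall := Multiset.all_zero_of_le_zero_le_of_sum_eq_zero hnn h0.symm
  rw [← CStarRing.star_mul_self_eq_zero_iff]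
  have hsr : spectralRadius ℂ (star x * x) = 0 := by
    refine le_antisymm (iSup₂_le fun c hc => ?_) bot_le
    simp [hall _ ((hroot c).2 hc)]
  rw [(IsSelfAdjoint.star_mul_self x).spectralRadius_eq_nnnorm] at hsr
  simpa using hsr

end RegularTrace

namespace CoinvBialg

variable {B : CoinvBialg.{u}}

/-! ### Invariance of the regular trace -/

section TraceExistence

variable (B) in
/-- The trace of the left regular representation. -/
noncomputable def regularTrace : B →ₗ[ℂ] ℂ := LinearMap.trace ℂ B ∘ₗ LinearMap.mul ℂ B

theorem regularTrace_apply (x : B) :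
    B.regularTrace x = LinearMap.trace ℂ B (LinearMap.mulLeft ℂ x) := rfl

theorem regularTrace_mul_comm (x y : B) : B.regularTrace (x * y) = B.regularTrace (y * x) := by
  rw [regularTrace_apply, regularTrace_apply, LinearMap.mulLeft_mul, LinearMap.mulLeft_mul,
    LinearMap.trace_comp_comm']

theorem regularTrace_S (x : B) :
    B.regularTrace (B.S x) = LinearMap.trace ℂ B (LinearMap.mulRight ℂ x) := by
  have h : LinearMap.mulRight ℂ x = B.S ∘ₗ (LinearMap.mulLeft ℂ (B.S x) ∘ₗ B.S) := by
    ext b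
    simp [B.S_mul, B.S_S]
  have hSS : B.S ∘ₗ B.S = LinearMap.id := LinearMap.ext B.S_S
  rw [h, LinearMap.trace_comp_comm', LinearMap.comp_assoc, hSS, LinearMap.comp_id,
    regularTrace_apply]

theorem sliceLeft_mul_S_tmul_one (α : B →ₗ[ℂ] ℂ) (a : B) (t : B ⊗[ℂ] B) :
    B.sliceLeft α (t * (B.S a ⊗ₜ (1 : B))) =
      B.sliceLeft (((LinearMap.mul ℂ B).flip ∘ₗ B.S).compr₂ α a) t := by
  induction t with
  | zero => simp
  | tmul u v => simp
  | add s t hs ht => simp only [add_mul, map_add, hs, ht]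

theorem sliceLeft_S_tmul_one_mul (α : B →ₗ[ℂ] ℂ) (a : B) (t : B ⊗[ℂ] B) :
    B.sliceLeft α ((B.S a ⊗ₜ (1 : B)) * t) =
      B.sliceLeft ((LinearMap.mul ℂ B ∘ₗ B.S).compr₂ α a) t := by
  induction t with
  | zero => simp
  | tmul u v => simp
  | add s t hs ht => simp only [mul_add, map_add, hs, ht]

/-- If `P(x) = (F(x₁) ⊗ id) Δ(Q(x₂))`, then the operator `P` has the trace of the operator
`x ↦ Q(F(x₂)(x₁) x₃)`. -/
theorem trace_eq_trace_comp_leftOp (P Q : B →ₗ[ℂ] B) (F : B →ₗ[ℂ] B →ₗ[ℂ] ℂ)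
    (E : B ⊗[ℂ] B →ₗ[ℂ] B) (hE : ∀ a c, E (a ⊗ₜ c) = B.sliceLeft (F a) (B.Δ (Q c)))
    (hP : ∀ x, P x = E (B.Δ x)) :
    LinearMap.trace ℂ B P =
      LinearMap.trace ℂ B (Q ∘ₗ B.leftOp (TensorProduct.lift F.flip ∘ₗ B.ΔLin)) := by
  let b := Module.finBasis ℂ B
  have key : ∀ t, E t =
      ∑ k, B.sliceLeft (F (b k)) (B.Δ (Q (B.sliceLeft (b.coord k) t))) := by
    intro t
    induction t with
    | zero => simp
    | add s t hs ht => simp only [map_add, Finset.sum_add_distrib, hs, ht]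
    | tmul a c =>
      simp only [hE, sliceLeft_tmul, map_smul]
      induction B.Δ (Q c) with
      | zero => simp
      | tmul u v =>
        simp only [sliceLeft_tmul, smul_smul]
        rw [← Finset.sum_smul]
        congr 1
        conv_lhs => rw [← b.sum_repr a]
        simp only [map_sum, map_smul, LinearMap.sum_apply, LinearMap.smul_apply, smul_eq_mul,
          Module.Basis.coord_apply]
      | add s t hs ht => simp only [map_add, smul_add, Finset.sum_add_distrib, hs, ht]
  -- Expanding `x₁` in the basis separates `P` into such products; cyclicity puts `Q` first, and the
  -- two remaining operators merge into that of one dual product.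
  have hPsum : P = ∑ k, B.leftOp (F (b k)) ∘ₗ Q ∘ₗ B.leftOp (b.coord k) := by
    ext x
    rw [hP, key, LinearMap.sum_apply]
    rfl
  have hsum : TensorProduct.lift F.flip ∘ₗ B.ΔLin =
      ∑ k, B.dualMul (F (b k)) (b.coord k) := by
    ext x
    simp only [LinearMap.sum_apply, dualMul_apply, LinearMap.comp_apply, ΔLin]
    change TensorProduct.lift F.flip (B.Δ x) = _
    induction B.Δ x with
    | zero => simp
    | tmul u v =>
      simp only [tensorFunctional_tmul, TensorProduct.lift.tmul, LinearMap.flip_apply]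
      conv_lhs => rw [← b.sum_repr v]
      simp only [map_sum, map_smul, LinearMap.sum_apply, LinearMap.smul_apply, smul_eq_mul,
        Module.Basis.coord_apply, mul_comm]
    | add s t hs ht => simp only [map_add, Finset.sum_add_distrib, hs, ht]
  have hQ : Q ∘ₗ B.leftOpLin (∑ k, B.dualMul (F (b k)) (b.coord k)) =
      ∑ k, Q ∘ₗ B.leftOpLin (B.dualMul (F (b k)) (b.coord k)) := by
    ext x
    simp only [map_sum, LinearMap.sum_apply, LinearMap.comp_apply]
  rw [hsum, hPsum, ← leftOpLin_apply, hQ, map_sum, map_sum]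
  refine Finset.sum_congr rfl fun k _ => ?_
  rw [leftOpLin_apply, ← leftOp_comp_leftOp, LinearMap.trace_comp_comm', LinearMap.comp_assoc]

variable (B) in
/-- The linear map `a ⊗ b ↦ Δ(b) (S(a) ⊗ 1)`. -/
noncomputable def ΔMulAntipode : B ⊗[ℂ] B →ₗ[ℂ] B ⊗[ℂ] B :=
  LinearMap.mul' ℂ (B ⊗[ℂ] B) ∘ₗ
    TensorProduct.map B.ΔLin ((TensorProduct.mk ℂ B B).flip 1 ∘ₗ B.S) ∘ₗ
      (TensorProduct.comm ℂ B B).toLinearMap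

@[simp]
theorem ΔMulAntipode_tmul (a b : B) :
    B.ΔMulAntipode (a ⊗ₜ b) = B.Δ b * (B.S a ⊗ₜ (1 : B)) := rfl

namespace SourceCompatible

theorem antipodeMulΔ_Δ (hs : B.SourceCompatible) (x : B) :
    B.antipodeMulΔ (B.Δ x) = ((1 : B) ⊗ₜ x) * B.e := by
  rw [← sourceMap_rTensor_Δ, hs]

theorem ΔMulAntipode_Δ (hs : B.SourceCompatible) (x : B) :
    B.ΔMulAntipode (B.Δ x) = B.e * ((1 : B) ⊗ₜ x) := by
  have key : ∀ t, B.ΔMulAntipode t = star (B.antipodeMulΔ (star t)) := by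
    intro t
    induction t with
    | zero => simp
    | tmul a b => simp [← map_star, B.S_star]
    | add s t hs ht => simp only [map_add, star_add, hs, ht]
  rw [key, ← map_star B.Δ, hs.antipodeMulΔ_Δ, star_mul, star_e]
  simp

theorem regularTrace_leftOp (hs : B.SourceCompatible) (α : B →ₗ[ℂ] ℂ) (x : B) :
    B.regularTrace (B.leftOp α x) =
      B.regularTrace (B.sliceLeft (α ∘ₗ B.S) B.e * x) := by
  -- `F(a) = α(· S(a))`: inserting `e (1 ⊗ y) = Δ(y₂)(S(y₁) ⊗ 1)` writes left multiplication by `L_α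
  -- x` as `y ↦ (F(y₁) ⊗ id) Δ(x y₂)`, and the contraction `F(y₂)(y₁)` is `α(ε_t(y))`.
  let F := ((LinearMap.mul ℂ B).flip ∘ₗ B.S).compr₂ α
  rw [regularTrace_apply, trace_eq_trace_comp_leftOp _ (LinearMap.mulLeft ℂ x) F
    (B.sliceLeft α ∘ₗ LinearMap.mulLeft ℂ (B.Δ x) ∘ₗ B.ΔMulAntipode), regularTrace_mul_comm,
    regularTrace_apply]
  · congr 1
    have hF : TensorProduct.lift F.flip ∘ₗ B.ΔLin = α ∘ₗ B.targetMap := by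
      rw [targetMap, ← LinearMap.comp_assoc, ← LinearMap.comp_assoc]
      congr 1
      ext u v
      simp [F]
    ext y
    rw [hF, LinearMap.comp_apply, leftOp_apply, ← sliceLeft_rTensor, hs.targetMap_rTensor_Δ,
      sliceLeft_rTensor, sliceLeft_mul_one_tmul]
    simp
  · intro a c
    simp only [LinearMap.comp_apply, ΔMulAntipode_tmul, LinearMap.mulLeft_apply, map_mul B.Δ]
    rw [← mul_assoc, sliceLeft_mul_S_tmul_one]
  · intro y
    simp only [LinearMap.comp_apply, LinearMap.mulLeft_apply, hs.ΔMulAntipode_Δ]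
    rw [← mul_assoc, Δ_mul_e, sliceLeft_mul_one_tmul, leftOp_apply]

theorem regularTrace_S_leftOp (hs : B.SourceCompatible) (α : B →ₗ[ℂ] ℂ) (x : B) :
    B.regularTrace (B.S (B.leftOp α x)) =
      B.regularTrace (B.S (B.sliceLeft (α ∘ₗ B.S) B.e * x)) := by
  let F := (LinearMap.mul ℂ B ∘ₗ B.S).compr₂ α
  rw [regularTrace_S, trace_eq_trace_comp_leftOp _ (LinearMap.mulRight ℂ x) F
    (B.sliceLeft α ∘ₗ LinearMap.mulRight ℂ (B.Δ x) ∘ₗ B.antipodeMulΔ), regularTrace_S]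
  · congr 1
    have hF : TensorProduct.lift F.flip ∘ₗ B.ΔLin = (α ∘ₗ B.S) ∘ₗ B.sourceMap := by
      rw [sourceMap, ← LinearMap.comp_assoc, ← LinearMap.comp_assoc]
      congr 1
      ext u v
      simp [F, B.S_mul, B.S_S]
    ext y
    rw [hF, LinearMap.comp_apply, leftOp_apply, ← sliceLeft_rTensor, hs,
      sliceLeft_one_tmul_mul]
    simp
  · intro a c
    simp only [LinearMap.comp_apply, antipodeMulΔ_tmul, LinearMap.mulRight_apply, map_mul B.Δ]
    rw [mul_assoc, sliceLeft_S_tmul_one_mul]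
  · intro y
    simp only [LinearMap.comp_apply, LinearMap.mulRight_apply, hs.antipodeMulΔ_Δ]
    rw [mul_assoc, e_mul_Δ, sliceLeft_one_tmul_mul, leftOp_apply]

/-- Adding the `S`-twist forces `S`-invariance. Tested on `α`, counital invariance says `φ(L_α x) =
φ((α ∘ S ⊗ id)(e) x)`, which holds for each summand. -/
theorem isCounitalHaarTrace (hs : B.SourceCompatible) :
    B.IsCounitalHaarTrace (B.regularTrace + B.regularTrace ∘ₗ B.S) where
  trace x y := by
    simp only [LinearMap.add_apply, LinearMap.comp_apply, B.S_mul]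
    rw [regularTrace_mul_comm, regularTrace_mul_comm (B.S y)]
  pos x hx := by
    have h1 := LinearMap.trace_mulLeft_star_mul_self_pos hx
    have hSx : B.S x ≠ 0 := fun h => hx (by rw [← B.S_S x, h, map_zero])
    have h2 := LinearMap.trace_mulLeft_star_mul_self_pos hSx
    rw [← regularTrace_apply] at h1 h2
    rw [LinearMap.add_apply, LinearMap.comp_apply, B.S_mul, regularTrace_mul_comm (B.S x),
      B.S_star]
    exact add_pos h1 h2
  comp_S x := by
    simp only [LinearMap.add_apply, LinearMap.comp_apply, B.S_S]
    exact add_comm _ _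
  invariant x := by
    refine B.eq_of_forall_functional fun α => ?_
    rw [hs.targetMap_rTensor_Δ, sliceRight_rTensor, ← tensorFunctional_eq_left,
      ← LinearMap.comp_apply, ← tensorFunctional_eq_left, tensorFunctional_eq_right,
      tensorFunctional_eq_right, sliceLeft_mul_one_tmul, ← leftOp_apply]
    simp only [LinearMap.add_apply, LinearMap.comp_apply]
    rw [hs.regularTrace_leftOp, hs.regularTrace_S_leftOp]

end SourceCompatible

end TraceExistence

end CoinvBialg

namespace CoinvBialg

variable {B C : CoinvBialg.{u}}

/-! ### Consequences for weak Kac algebras and Haar traces -/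

section WeakKac

theorem IsWeakKac.sourceCompatible {ε : B →ₗ[ℂ] ℂ} (h : B.IsWeakKac ε) : B.SourceCompatible :=
  h.source

theorem IsWeakKac.isDualUnit {ε : B →ₗ[ℂ] ℂ} (h : B.IsWeakKac ε) : B.IsDualUnit ε := by
  intro α
  constructor <;> ext x
  · rw [dualMul_apply, tensorFunctional_eq_right, h.counit_left]
  · rw [dualMul_apply, tensorFunctional_eq_left, h.counit_right]

theorem IsHaarTrace.existsUnique_isDualUnit {φ : B →ₗ[ℂ] ℂ} (h : B.IsHaarTrace φ) :
    ∃! y : B, B.IsDualUnit (B.densityFunctional φ y) := by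
  obtain ⟨ε, hε⟩ := h.exists_isDualUnit
  obtain ⟨y, rfl⟩ := h.exists_densityFunctional ε
  exact ⟨y, hε, fun z hz => h.densityFunctional_injective (hz.unique hε)⟩

theorem IsHaarTrace.existsUnique_isNormalized {φ : B →ₗ[ℂ] ℂ} (h : B.IsHaarTrace φ) :
    ∃! ψ : B →ₗ[ℂ] ℂ, B.IsHaarTrace ψ ∧ B.IsNormalized ψ := by
  obtain ⟨ε, hε⟩ := h.exists_isDualUnit
  obtain ⟨ψ, hψ⟩ := h.exists_isNormalized hε
  exact ⟨ψ, hψ, fun χ hχ => hχ.1.eq_of_isNormalized hψ.1 hχ.2 hψ.2⟩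

theorem SourceCompatible.isCounitalHaarTrace_iff (hs : B.SourceCompatible) (φ : B →ₗ[ℂ] ℂ) :
    B.IsCounitalHaarTrace φ ↔ B.IsHaarTrace φ :=
  ⟨fun h => h.isHaarTrace hs, fun h => h.isCounitalHaarTrace⟩

end WeakKac

/-! ### Injectivity, dual units and Haar traces under homomorphisms -/

section Homomorphisms

theorem Hom.lin_mul (π : B.Hom C) (x y : B) : π.lin (x * y) = π.lin x * π.lin y :=
  map_mul π.toFun x y

theorem Hom.lin_star (π : B.Hom C) (x : B) : π.lin (star x) = star (π.lin x) :=
  map_star π.toFun x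

theorem Hom.lin_one (π : B.Hom C) : π.lin 1 = 1 := map_one π.toFun

theorem Hom.lin_S (π : B.Hom C) (x : B) : π.lin (B.S x) = C.S (π.lin x) := (π.map_S x).symm

theorem Hom.lin_Δ (π : B.Hom C) (x : B) :
    C.Δ (π.lin x) = TensorProduct.map π.lin π.lin (B.Δ x) := π.map_Δ x

theorem Hom.sliceRight_map (π : B.Hom C) (α : C →ₗ[ℂ] ℂ) (t : B ⊗[ℂ] B) :
    C.sliceRight α (TensorProduct.map π.lin π.lin t) =
      π.lin (B.sliceRight (α ∘ₗ π.lin) t) := by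
  induction t with
  | zero => simp
  | tmul a b => simp
  | add s t hs ht => simp only [map_add, hs, ht]

theorem Hom.dualMul_comp (π : B.Hom C) (α β : C →ₗ[ℂ] ℂ) :
    B.dualMul (α ∘ₗ π.lin) (β ∘ₗ π.lin) = C.dualMul α β ∘ₗ π.lin := by
  ext x
  rw [LinearMap.comp_apply, dualMul_apply, dualMul_apply, π.lin_Δ]
  induction B.Δ x with
  | zero => simp
  | tmul a b => simp
  | add s t hs ht => simp only [map_add, hs, ht]

theorem Hom.lin_targetMap (π : B.Hom C) (x : B) :
    π.lin (B.targetMap x) = C.targetMap (π.lin x) := by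
  change π.lin (LinearMap.mul' ℂ B (B.S.lTensor B (B.Δ x))) =
    LinearMap.mul' ℂ C (C.S.lTensor C (C.Δ (π.lin x)))
  rw [π.lin_Δ]
  induction B.Δ x with
  | zero => simp
  | tmul a b => simp [π.lin_mul, π.lin_S]
  | add s t hs ht => simp only [map_add, hs, ht]

/-- Every functional on the source factors through an injective `π`, and the transpose of `π` is
multiplicative. -/
theorem preservesDualUnit_of_injective (π : B.Hom C) (hπ : Function.Injective π.lin) :
    preservesDualUnit π := by
  intro υ hυ α
  obtain ⟨g, hg⟩ := LinearMap.exists_leftInverse_of_injective π.lin (LinearMap.ker_eq_bot.2 hπ)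
  have hα : α = (α ∘ₗ g) ∘ₗ π.lin := by rw [LinearMap.comp_assoc, hg, LinearMap.comp_id]
  rw [hα, π.dualMul_comp, π.dualMul_comp, (hυ _).1, (hυ _).2]
  exact ⟨rfl, rfl⟩

theorem preservesHaar.injective {π : B.Hom C} (hπ : preservesHaar π) {φ : C →ₗ[ℂ] ℂ}
    (hφ : C.IsHaarTrace φ) : Function.Injective π.lin := by
  obtain ⟨ψ, hψ, -⟩ := hφ.existsUnique_isNormalized
  have h := (hπ ψ hψ.1 hψ.2).1
  rw [injective_iff_map_eq_zero]
  intro x hx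
  by_contra hne
  have h1 := h.pos x hne
  rw [LinearMap.comp_apply, π.lin_mul, hx, mul_zero, map_zero] at h1
  exact lt_irrefl _ h1

theorem preservesHaar_of_injective {π : B.Hom C} (hπ : Function.Injective π.lin)
    (hs : B.SourceCompatible) : preservesHaar π := by
  intro ψ hψ hψ'
  refine ⟨IsCounitalHaarTrace.isHaarTrace
    { trace := ?_, pos := ?_, comp_S := ?_, invariant := ?_ } hs, ?_⟩
  · intro x y
    rw [LinearMap.comp_apply, LinearMap.comp_apply, π.lin_mul, π.lin_mul, hψ.trace]
  · intro x hx
    rw [LinearMap.comp_apply, π.lin_mul, π.lin_star]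
    exact hψ.pos _ fun h => hx (hπ (by rw [h, map_zero]))
  · intro x
    rw [LinearMap.comp_apply, π.lin_S, hψ.comp_S, LinearMap.comp_apply]
  -- Injectivity lets this be checked after `π`, where it says that `ε_t` fixes `(id ⊗ ψ)Δ(π(x))`.
  · intro x
    apply hπ
    rw [sliceRight_rTensor, π.lin_targetMap, ← π.sliceRight_map, ← π.lin_Δ,
      hψ.targetMap_sliceRight_Δ]
  · apply hπ
    rw [← π.sliceRight_map, e, ← π.lin_Δ, π.lin_one]
    exact hψ'

end Homomorphisms

end CoinvBialg

/-! ### The two equivalences of categories -/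

namespace GenKacAlg

/-- The element of a generalized Kac algebra that represents the unit of the dual algebra. -/
noncomputable def dualOne (X : GenKacAlg.{u}) : X.bialg :=
  X.isHaarTrace.existsUnique_isDualUnit.choose

/-- The counit of a generalized Kac algebra. -/
noncomputable def counit (X : GenKacAlg.{u}) : X.bialg →ₗ[ℂ] ℂ :=
  X.bialg.densityFunctional X.φ X.dualOne

theorem isDualUnit_counit (X : GenKacAlg.{u}) : X.bialg.IsDualUnit X.counit :=
  X.isHaarTrace.existsUnique_isDualUnit.choose_spec.1

theorem isWeakKac_counit (X : GenKacAlg.{u}) : X.bialg.IsWeakKac X.counit :=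
  X.isHaarTrace.isWeakKac X.isDualUnit_counit

/-- The weak Kac algebra of a generalized Kac algebra. -/
noncomputable def toWeakKac (X : GenKacAlg.{u}) : WeakKacAlg.{u} :=
  ⟨X.bialg, X.counit, X.isWeakKac_counit⟩

theorem toWeakKac_eq (X : GenKacAlg.{u}) (y : X.bialg)
    (hy : X.bialg.IsDualUnit (X.bialg.densityFunctional X.φ y)) :
    ∃ h : X.bialg.IsWeakKac (X.bialg.densityFunctional X.φ y),
      X.toWeakKac = ⟨X.bialg, X.bialg.densityFunctional X.φ y, h⟩ := by
  refine ⟨X.isHaarTrace.isWeakKac hy, ?_⟩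
  have h : X.counit = X.bialg.densityFunctional X.φ y := X.isDualUnit_counit.unique hy
  simp only [toWeakKac, h]

/-- A homomorphism of bialgebras that preserves the dual units, as a homomorphism of weak Kac
algebras. -/
noncomputable def toWeakKacHom {X Y : GenKacAlg.{u}} (f : X.bialg ⟶ Y.bialg)
    (hf : CoinvBialg.preservesDualUnit f) : X.toWeakKac ⟶ Y.toWeakKac :=
  ⟨f, (hf _ Y.isDualUnit_counit).unique X.isDualUnit_counit⟩

theorem preservesDualUnit_of_hom {X Y : GenKacAlg.{u}} (f : X.toWeakKac ⟶ Y.toWeakKac) :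
    CoinvBialg.preservesDualUnit f.hom := by
  intro υ hυ
  have h1 : υ = Y.counit := hυ.unique Y.isDualUnit_counit
  have h2 : υ ∘ₗ CoinvBialg.Hom.lin f.hom = X.counit := by
    rw [h1]
    exact f.map_ε
  rw [h2]
  exact X.isDualUnit_counit

/-- Equip the bialgebra with the symmetrized regular trace. The resulting counit is the unit of the
dual, so it is the given one and the objects are equal, not merely isomorphic. -/
theorem exists_toWeakKac_eq (W : WeakKacAlg.{u}) : ∃ X : GenKacAlg.{u}, X.toWeakKac = W := by
  have hs := W.isWeakKac.sourceCompatible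
  let X : GenKacAlg.{u} := ⟨W.bialg, _, hs.isCounitalHaarTrace.isHaarTrace hs⟩
  refine ⟨X, ?_⟩
  obtain ⟨B, ε, h⟩ := W
  have hε : X.counit = ε := X.isDualUnit_counit.unique h.isDualUnit
  simp only [toWeakKac, hε, X]

/-- The functor from generalized Kac algebras to weak Kac algebras, on the homomorphisms that
preserve the dual units. -/
noncomputable def counitFunctor : GenKacCounitCat.{u} ⥤ WeakKacAlg.{u} where
  obj X := GenKacAlg.toWeakKac X
  map f := toWeakKacHom f.hom f.property

instance : counitFunctor.{u}.Faithful where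
  map_injective {_ _ f g} h := by
    have h1 : f.hom = g.hom := congrArg WeakKacAlg.Hom.hom h
    exact InducedWideCategory.Hom.ext h1

instance : counitFunctor.{u}.Full where
  map_surjective f := ⟨⟨f.hom, preservesDualUnit_of_hom f⟩, rfl⟩

instance : counitFunctor.{u}.EssSurj where
  mem_essImage W := by
    obtain ⟨X, hX⟩ := exists_toWeakKac_eq W
    exact ⟨X, ⟨eqToIso hX⟩⟩

instance : counitFunctor.{u}.IsEquivalence where

/-- The functor from generalized Kac algebras to weak Kac algebras with injective homomorphisms,
on the homomorphisms that preserve the normalized Haar traces. -/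
noncomputable def haarFunctor : GenKacCat.{u} ⥤ WeakKacInjCat.{u} where
  obj X := ⟨GenKacAlg.toWeakKac X⟩
  map {_ Y} f :=
    have hinj := CoinvBialg.preservesHaar.injective f.property (GenKacAlg.isHaarTrace Y)
    ⟨toWeakKacHom f.hom (CoinvBialg.preservesDualUnit_of_injective f.hom hinj), hinj⟩

instance : haarFunctor.{u}.Faithful where
  map_injective {_ _ f g} h := by
    have h1 : f.hom = g.hom :=
      congrArg (fun k => WeakKacAlg.Hom.hom (InducedWideCategory.Hom.hom k)) h
    exact InducedWideCategory.Hom.ext h1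

instance : haarFunctor.{u}.Full where
  map_surjective {X _} f := ⟨⟨f.hom.hom, CoinvBialg.preservesHaar_of_injective f.property
    (GenKacAlg.isHaarTrace X).sourceCompatible⟩, rfl⟩

instance : haarFunctor.{u}.EssSurj where
  mem_essImage W := by
    obtain ⟨X, hX⟩ := exists_toWeakKac_eq W.obj
    exact ⟨X, ⟨eqToIso (WideSubcategory.ext hX)⟩⟩

instance : haarFunctor.{u}.IsEquivalence where

end GenKacAlg

theorem mainTheorem1 :
    -- every generalized Kac algebra is a weak Kac algebra, with a unique normalized Haar trace
    (∀ (B : CoinvBialg.{u}) (φ : B →ₗ[ℂ] ℂ), B.IsHaarTrace φ →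
      (∃! y : B, B.IsDualUnit (B.densityFunctional φ y)) ∧
      (∀ y : B, B.IsDualUnit (B.densityFunctional φ y) →
        B.IsWeakKac (B.densityFunctional φ y)) ∧
      (∃! ψ : B →ₗ[ℂ] ℂ, B.IsHaarTrace ψ ∧ B.IsNormalized ψ) ∧
      (∃! ψ : B →ₗ[ℂ] ℂ, B.IsCounitalHaarTrace ψ ∧ B.IsNormalized ψ)) ∧
    -- the converse
    (∀ (B : CoinvBialg.{u}) (ε : B →ₗ[ℂ] ℂ), B.IsWeakKac ε →
      B.IsDualUnit ε ∧ (∃ φ : B →ₗ[ℂ] ℂ, B.IsCounitalHaarTrace φ) ∧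
      ∀ φ : B →ₗ[ℂ] ℂ, B.IsCounitalHaarTrace φ → B.IsHaarTrace φ) ∧
    -- the equivalence with homomorphisms that preserve the normalized Haar traces
    (∃ F : GenKacCat.{u} ⥤ WeakKacInjCat.{u}, F.IsEquivalence ∧
      (∀ (X : GenKacAlg.{u}) (y : X.bialg), X.bialg.IsDualUnit (X.bialg.densityFunctional X.φ y) →
        ∃ h : X.bialg.IsWeakKac (X.bialg.densityFunctional X.φ y),
          (F.obj X).obj = ⟨X.bialg, X.bialg.densityFunctional X.φ y, h⟩) ∧
      F ⋙ wideSubcategoryInclusion WeakKacAlg.injective ⋙ WeakKacAlg.forgetCounit =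
        wideInducedFunctor GenKacAlg.bialg CoinvBialg.preservesHaar) ∧
    -- the equivalence with homomorphisms that preserve the counits
    (∃ F : GenKacCounitCat.{u} ⥤ WeakKacAlg.{u}, F.IsEquivalence ∧
      (∀ (X : GenKacAlg.{u}) (y : X.bialg), X.bialg.IsDualUnit (X.bialg.densityFunctional X.φ y) →
        ∃ h : X.bialg.IsWeakKac (X.bialg.densityFunctional X.φ y),
          F.obj X = ⟨X.bialg, X.bialg.densityFunctional X.φ y, h⟩) ∧
      F ⋙ WeakKacAlg.forgetCounit =
        wideInducedFunctor GenKacAlg.bialg CoinvBialg.preservesDualUnit) := by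
  refine ⟨fun B φ h => ⟨h.existsUnique_isDualUnit, fun y hy => h.isWeakKac hy,
      h.existsUnique_isNormalized, ?_⟩,
    fun B ε h => ⟨h.isDualUnit, ⟨_, h.sourceCompatible.isCounitalHaarTrace⟩,
      fun φ hφ => hφ.isHaarTrace h.sourceCompatible⟩,
    ⟨GenKacAlg.haarFunctor, inferInstance, fun X y hy => X.toWeakKac_eq y hy, rfl⟩,
    ⟨GenKacAlg.counitFunctor, inferInstance, fun X y hy => X.toWeakKac_eq y hy, rfl⟩⟩
  simp only [h.sourceCompatible.isCounitalHaarTrace_iff]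
  exact h.existsUnique_isNormalized
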